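/- Let $\mathbb M^2\subset\mathbb C^{1+8}$ be the real submanifold given, in coordinates $(z,w^1,\dots,w^8)$, by $$\begin{aligned} w^1-\overline w^1&=2i\,z\overline z, & w^2-\overline w^2&=2i\,(z^2\overline z+z\overline z^2),\\ w^3-\overline w^3&=2\,(z^2\overline z-z\overline z^2), & w^4-\overline w^4&=2i\,(z^3\overline z+z\overline z^3),\\ w^5-\overline w^5&=2\,(z^3\overline z-z\overline z^3), & w^6-\overline w^6&=2i\,z^2\overline z^2,\\ w^7-\overline w^7&=2i\,(z^3\overline z^2+z^2\overline z^3), & w^8-\overline w^8&=2\,(z^3\overline z^2-z^2\overline z^3). \end{aligned}$$ Let $\mathfrak{aut}_{CR}(\mathbb M^2)$ be the real Lie algebra, under the usual bracket, of germs at the origin of vector fields $\mathsf X=Z(z,w)\,\partial_z+\sum_{l=1}^8W^l(z,w)\,\partial_{w^l}$ with holomorphic coefficients such that $\mathsf X+\overline{\mathsf X}$ is tangent to $\mathbb M^2$ near the origin. Then $\dim_{\mathbb R}\mathfrak{aut}_{CR}(\mathbb M^2)=12$, and the following hold. (1) General coefficients: $\mathsf X\in\mathfrak{aut}_{CR}(\mathbb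 M^2)$ if and only if there are real constants $c_1,\dots,c_8,a,b,c,d$ with $$\begin{aligned} Z&=c+id+(a+ib)z,\\ W^1&=c_1+2a\,w^1+2(d+ic)z,\\ W^2&=c_2+4c\,w^1+3a\,w^2-b\,w^3+2(d+ic)z^2,\\ W^3&=c_3+4d\,w^1+b\,w^2+3a\,w^3+2(c-id)z^2,\\ W^4&=c_4+3c\,w^2-3d\,w^3+4a\,w^4-2b\,w^5+2(d+ic)z^3,\\ W^5&=c_5+3d\,w^2+3c\,w^3+2b\,w^4+4a\,w^5+2(c-id)z^3,\\ W^6&=c_6+2c\,w^2+2d\,w^3+4a\,w^6,\\ W^7&=c_7+2c\,w^4+2d\,w^5+6c\,w^6+5a\,w^7-b\,w^8,\\ W^8&=c_8-2d\,w^4+2c\,w^5+6d\,w^6+b\,w^7+5a\,w^8. \end{aligned}$$ (2) Basis: the following twelve vector fields form an $\mathbb R$-basis of $\mathfrak{aut}_{CR}(\mathbb M^2)$: $\mathsf X_i=\partial_{w^i}$ for $i=1,\dots,8$, and $$\begin{aligned} \mathsf X_9={}&z\partial_z+2w^1\partial_{w^1}+3w^2\partial_{w^2}+3w^3\partial_{w^3}+4w^4\partial_{w^4}+4w^5\partial_{w^5}+4w^6\partial_{w^6}+5w^7\partial_{w^7}+5w^8\partial_{w^8},\\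 \mathsf X_{10}={}&iz\partial_z-w^3\partial_{w^2}+w^2\partial_{w^3}-2w^5\partial_{w^4}+2w^4\partial_{w^5}-w^8\partial_{w^7}+w^7\partial_{w^8},\\ \mathsf X_{11}={}&\partial_z+2iz\,\partial_{w^1}+(4w^1+2iz^2)\partial_{w^2}+2z^2\partial_{w^3}+(3w^2+2iz^3)\partial_{w^4}+(3w^3+2z^3)\partial_{w^5}\\ &+2w^2\partial_{w^6}+(2w^4+6w^6)\partial_{w^7}+2w^5\partial_{w^8},\\ \mathsf X_{12}={}&i\partial_z+2z\,\partial_{w^1}+2z^2\partial_{w^2}+(4w^1-2iz^2)\partial_{w^3}+(-3w^3+2z^3)\partial_{w^4}+(3w^2-2iz^3)\partial_{w^5}\\ &+2w^3\partial_{w^6}+2w^5\partial_{w^7}+(-2w^4+6w^6)\partial_{w^8}. \end{aligned}$$ (3) Grading: $\mathfrak{aut}_{CR}(\mathbb M^2)=\mathfrak g_{-5}\oplus\mathfrak g_{-4}\oplus\mathfrak g_{-3}\oplus\mathfrak g_{-2}\oplus\mathfrak g_{-1}\oplus\mathfrak g_0$, where $\mathfrak g_{-5}=\langle\mathsf X_7,\mathsf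 X_8\rangle$, $\mathfrak g_{-4}=\langle\mathsf X_4,\mathsf X_5,\mathsf X_6\rangle$, $\mathfrak g_{-3}=\langle\mathsf X_2,\mathsf X_3\rangle$, $\mathfrak g_{-2}=\langle\mathsf X_1\rangle$, $\mathfrak g_{-1}=\langle\mathsf X_{11},\mathsf X_{12}\rangle$, $\mathfrak g_0=\langle\mathsf X_9,\mathsf X_{10}\rangle$ are real spans, and $[\mathfrak g_k,\mathfrak g_l]\subset\mathfrak g_{k+l}$ for all integers $k,l$, with $\mathfrak g_k=0$ for $k\notin\{-5,\dots,0\}$. (4) Commutators: $[\mathsf X_i,\mathsf X_j]=0$ for $1\le i\le j\le 8$; the brackets $[\mathsf X_i,\mathsf X_j]$ with $j\geq 9$ and $i\leq j$ are given by the table (row $i$, column $j$) $$\begin{array}{c|cccc} &\mathsf X_9&\mathsf X_{10}&\mathsf X_{11}&\mathsf X_{12}\\ \hline \mathsf X_1&2\mathsf X_1&0&4\mathsf X_2&4\mathsf X_3\\ \mathsf X_2&3\mathsf X_2&\mathsf X_3&3\mathsf X_4+2\mathsf X_6&3\mathsf X_5\\ \mathsf X_3&3\mathsf X_3&-\mathsf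 X_2&3\mathsf X_5&-3\mathsf X_4+2\mathsf X_6\\ \mathsf X_4&4\mathsf X_4&2\mathsf X_5&2\mathsf X_7&-2\mathsf X_8\\ \mathsf X_5&4\mathsf X_5&-2\mathsf X_4&2\mathsf X_8&2\mathsf X_7\\ \mathsf X_6&4\mathsf X_6&0&6\mathsf X_7&6\mathsf X_8\\ \mathsf X_7&5\mathsf X_7&\mathsf X_8&0&0\\ \mathsf X_8&5\mathsf X_8&-\mathsf X_7&0&0\\ \mathsf X_9&0&0&-\mathsf X_{11}&-\mathsf X_{12}\\ \mathsf X_{10}&&0&-\mathsf X_{12}&\mathsf X_{11}\\ \mathsf X_{11}&&&0&4\mathsf X_1\\ \mathsf X_{12}&&&&0 \end{array}$$ and all other brackets follow by antisymmetry. -/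

import Mathlib

open Filter Topology Complex

namespace CRModel

/-- The space `ℂ^{1+8}` with coordinates `(z, w^1, …, w^8)`; the coordinate `w^j` of `p` is
`p.2 (j - 1)`. -/
abbrev Amb : Type := ℂ × (Fin 8 → ℂ)

/-! ### The Lie algebra of germs at `0` of holomorphic vector fields

A vector field `Z ∂_z + ∑ W^l ∂_{w^l}` is given by its coefficient map `(Z, W^1, …, W^8)`. -/

/-- Germs at the origin of vector fields of `ℂ^{1+8}` whose coefficients are holomorphic, that is,
sums of convergent power series in `(z, w)`. -/
def HolVF : Submodule ℝ (Germ (𝓝 (0 : Amb)) Amb) where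
  carrier := {X | ∃ V : Amb → Amb, AnalyticAt ℂ V 0 ∧ X = (V : Germ (𝓝 (0 : Amb)) Amb)}
  add_mem' := by
    rintro _ _ ⟨V, hV, rfl⟩ ⟨W, hW, rfl⟩
    exact ⟨V + W, hV.add hW, rfl⟩
  zero_mem' := ⟨0, analyticAt_const, rfl⟩
  smul_mem' := by
    rintro r _ ⟨V, hV, rfl⟩
    refine ⟨r • V, ?_, rfl⟩
    have h : r • V = (r : ℂ) • V := by
      funext p
      simp [Complex.coe_smul]
    rw [h]
    exact hV.const_smul

/-- The Lie bracket of two germs of vector fields, computed on representatives: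
`[V, W] = DW · V - DV · W`. -/
noncomputable def germBracket (X Y : Germ (𝓝 (0 : Amb)) Amb) : Germ (𝓝 (0 : Amb)) Amb :=
  Quotient.map₂ (VectorField.lieBracket ℂ)
    (fun _ _ hV _ _ hW => Filter.EventuallyEq.lieBracket_vectorField hV hW) X Y

theorem germBracket_coe (V W : Amb → Amb) :
    germBracket (V : Germ (𝓝 (0 : Amb)) Amb) W = (VectorField.lieBracket ℂ V W : Amb → Amb) :=
  rfl

theorem analyticAt_lieBracket {V W : Amb → Amb} {p : Amb} (hV : AnalyticAt ℂ V p)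
    (hW : AnalyticAt ℂ W p) : AnalyticAt ℂ (VectorField.lieBracket ℂ V W) p :=
  (ContDiffAt.lieBracket_vectorField (m := ⊤) (n := ⊤) hV.contDiffAt hW.contDiffAt
    le_top).analyticAt

noncomputable instance : Bracket HolVF HolVF where
  bracket X Y := ⟨germBracket X Y, by
    obtain ⟨_, V, hV, rfl⟩ := X
    obtain ⟨_, W, hW, rfl⟩ := Y
    exact ⟨_, analyticAt_lieBracket hV hW, rfl⟩⟩

theorem coe_bracket (X Y : HolVF) :
    ((⁅X, Y⁆ : HolVF) : Germ (𝓝 (0 : Amb)) Amb) = germBracket X Y := rfl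

noncomputable instance : LieRing HolVF where
  add_lie := by
    rintro ⟨_, U, hU, rfl⟩ ⟨_, V, hV, rfl⟩ ⟨_, W, hW, rfl⟩
    refine Subtype.ext (Germ.coe_eq.2 ?_)
    filter_upwards [hU.eventually_analyticAt, hV.eventually_analyticAt] with p h1 h2
    exact VectorField.lieBracket_add_left h1.differentiableAt h2.differentiableAt
  lie_add := by
    rintro ⟨_, U, hU, rfl⟩ ⟨_, V, hV, rfl⟩ ⟨_, W, hW, rfl⟩
    refine Subtype.ext (Germ.coe_eq.2 ?_)
    filter_upwards [hV.eventually_analyticAt, hW.eventually_analyticAt] with p h1 h2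
    exact VectorField.lieBracket_add_right h1.differentiableAt h2.differentiableAt
  lie_self := by
    rintro ⟨_, U, hU, rfl⟩
    refine Subtype.ext (Germ.coe_eq.2 ?_)
    exact Filter.Eventually.of_forall fun p => by simp
  leibniz_lie := by
    rintro ⟨_, U, hU, rfl⟩ ⟨_, V, hV, rfl⟩ ⟨_, W, hW, rfl⟩
    refine Subtype.ext (Germ.coe_eq.2 ?_)
    filter_upwards [hU.eventually_analyticAt, hV.eventually_analyticAt,
      hW.eventually_analyticAt] with p h1 h2 h3
    exact VectorField.leibniz_identity_lieBracket (n := minSmoothness ℂ 2) le_rfl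
      h1.contDiffAt h2.contDiffAt h3.contDiffAt

noncomputable instance : LieAlgebra ℝ HolVF where
  lie_smul := by
    rintro r ⟨_, U, hU, rfl⟩ ⟨_, V, hV, rfl⟩
    refine Subtype.ext (Germ.coe_eq.2 ?_)
    filter_upwards [hV.eventually_analyticAt] with p h2
    have h : r • V = (r : ℂ) • V := by
      funext p
      simp [Complex.coe_smul]
    change VectorField.lieBracket ℂ U (r • V) p = r • VectorField.lieBracket ℂ U V p
    rw [h, VectorField.lieBracket_const_smul_right h2.differentiableAt, Complex.coe_smul]

/-! ### The second model -/

/-- The right-hand sides `Ξ_1, …, Ξ_8` of the defining equations `w^j - conj w^j = Ξ_j`. -/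
noncomputable def Xi (z : ℂ) : Fin 8 → ℂ :=
  let y : ℂ := starRingEnd ℂ z
  ![2 * I * (z * y),
    2 * I * (z ^ 2 * y + z * y ^ 2),
    2 * (z ^ 2 * y - z * y ^ 2),
    2 * I * (z ^ 3 * y + z * y ^ 3),
    2 * (z ^ 3 * y - z * y ^ 3),
    2 * I * (z ^ 2 * y ^ 2),
    2 * I * (z ^ 3 * y ^ 2 + z ^ 2 * y ^ 3),
    2 * (z ^ 3 * y ^ 2 - z ^ 2 * y ^ 3)]

/-- The defining functions `w^j - conj w^j - Ξ_j(z, conj z)`. -/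
noncomputable def rho (j : Fin 8) (p : Amb) : ℂ :=
  p.2 j - starRingEnd ℂ (p.2 j) - Xi p.1 j

/-- The second model, a real submanifold of `ℂ^{1+8}` through the origin. -/
def secondModel : Set Amb := {p | ∀ j, rho j p = 0}

/-- The real vector field `X + conj X` is tangent to the second model near the origin: it
annihilates each defining function at the points of the model. For a function `f`, the value
`(X + conj X) f` at `p` is the real differential of `f` at `p` applied to the coefficient vector
of `X` at `p`. -/
def IsTangent (V : Amb → Amb) : Prop :=
  ∀ᶠ p in 𝓝 (0 : Amb), p ∈ secondModel → ∀ j, fderiv ℝ (rho j) p (V p) = 0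

theorem IsTangent.congr {V W : Amb → Amb} (h : V =ᶠ[𝓝 0] W) (hV : IsTangent V) :
    IsTangent W := by
  unfold IsTangent at *
  filter_upwards [h, hV] with p h1 h2
  rwa [← h1]

theorem contDiff_Xi (j : Fin 8) : ContDiff ℝ 2 (fun z => Xi z j) := by
  have hc : ContDiff ℝ 2 (fun z : ℂ => starRingEnd ℂ z) := conjCLE.contDiff
  have hz : ContDiff ℝ 2 (fun z : ℂ => z) := contDiff_id
  fin_cases j <;> simp [Xi] <;> fun_prop

theorem conj_Xi (z : ℂ) (j : Fin 8) : starRingEnd ℂ (Xi z j) = - Xi z j := by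
  have h2 : starRingEnd ℂ 2 = 2 := Complex.conj_ofNat 2
  fin_cases j <;> simp [Xi, h2] <;> ring

theorem contDiff_rho (j : Fin 8) : ContDiff ℝ 2 (rho j) := by
  have h1 : ContDiff ℝ 2 (fun p : Amb => p.2 j) := by fun_prop
  have h2 : ContDiff ℝ 2 (fun p : Amb => starRingEnd ℂ (p.2 j)) := conjCLE.contDiff.comp h1
  exact (h1.sub h2).sub ((contDiff_Xi j).comp contDiff_fst)

theorem fderiv_rho (j : Fin 8) (p v : Amb) :
    fderiv ℝ (rho j) p v
      = v.2 j - starRingEnd ℂ (v.2 j) - fderiv ℝ (fun z => Xi z j) p.1 v.1 := by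
  have h1 : HasFDerivAt (fun q : Amb => q.2 j)
      ((ContinuousLinearMap.proj (R := ℝ) (φ := fun _ : Fin 8 => ℂ) j).comp
        (ContinuousLinearMap.snd ℝ ℂ (Fin 8 → ℂ))) p :=
    ((ContinuousLinearMap.proj (R := ℝ) (φ := fun _ : Fin 8 => ℂ) j).comp
      (ContinuousLinearMap.snd ℝ ℂ (Fin 8 → ℂ))).hasFDerivAt
  have h2 := (conjCLE : ℂ ≃L[ℝ] ℂ).hasFDerivAt.comp p h1
  have h3 : HasFDerivAt (fun q : Amb => Xi q.1 j) _ p :=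
    HasFDerivAt.comp p
      (((contDiff_Xi j).differentiable (by norm_num)) p.1).hasFDerivAt
      (hasFDerivAt_fst (𝕜 := ℝ) (p := p))
  have h4 := ((h1.sub h2).sub h3).fderiv
  have h5 : rho j = (((fun q : Amb => q.2 j) - (⇑conjCLE ∘ fun q : Amb => q.2 j))
      - fun q : Amb => Xi q.1 j) := by
    funext q
    simp [rho]
  rw [h5, h4]
  simp

/-- A function that vanishes on the model near `p` has zero derivative along tangent vectors. -/
theorem fderiv_eq_zero_of_tangent {p v : Amb} (hp : p ∈ secondModel)
    (hv : ∀ j, fderiv ℝ (rho j) p v = 0) {f : Amb → ℂ} (hf : DifferentiableAt ℝ f p)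
    (h0 : ∀ᶠ q in 𝓝 p, q ∈ secondModel → f q = 0) : fderiv ℝ f p v = 0 := by
  let γ : ℝ → Amb := fun t =>
    (p.1 + t • v.1, fun j => p.2 j + t • (((v.2 j).re : ℝ) : ℂ)
      + (1 / 2 : ℂ) * (Xi (p.1 + t • v.1) j - Xi p.1 j))
  have hγ0 : γ 0 = p := by
    ext <;> simp [γ]
  have hγM : ∀ t, γ t ∈ secondModel := by
    intro t j
    have h := hp j
    simp only [rho] at h
    simp only [rho, γ, map_add, map_mul, map_sub, conj_Xi]
    have h2 : starRingEnd ℂ 2 = 2 := Complex.conj_ofNat 2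
    simp [h2]
    linear_combination h
  have hline : HasDerivAt (fun t : ℝ => p.1 + t • v.1) v.1 0 := by
    simpa using ((hasDerivAt_id (0 : ℝ)).smul_const v.1).const_add p.1
  have hγ : HasDerivAt γ v 0 := by
    have hv' : v = (v.1, v.2) := rfl
    rw [hv']
    refine hline.prodMk (hasDerivAt_pi.2 fun j => ?_)
    have h1 : HasDerivAt (fun t : ℝ => Xi (p.1 + t • v.1) j)
        (fderiv ℝ (fun z => Xi z j) p.1 v.1) 0 := by
      have h2 : HasFDerivAt (fun z => Xi z j) (fderiv ℝ (fun z => Xi z j) p.1)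
          (p.1 + (0 : ℝ) • v.1) := by
        simpa using (((contDiff_Xi j).differentiable (by norm_num)) p.1).hasFDerivAt
      exact h2.comp_hasDerivAt (0 : ℝ) hline
    have h3 : HasDerivAt (fun t : ℝ => p.2 j + t • (((v.2 j).re : ℝ) : ℂ))
        (((v.2 j).re : ℝ) : ℂ) 0 := by
      simpa using ((hasDerivAt_id (0 : ℝ)).smul_const (((v.2 j).re : ℝ) : ℂ)).const_add (p.2 j)
    have h4 := h3.add ((h1.sub_const (Xi p.1 j)).const_mul (1 / 2 : ℂ))
    have h5 := hv j
    rw [fderiv_rho] at h5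
    have h6 : v.2 j = (((v.2 j).re : ℝ) : ℂ)
        + (1 / 2 : ℂ) * (fderiv ℝ (fun z => Xi z j) p.1 v.1) := by
      have h7 := Complex.add_conj (v.2 j)
      push_cast at h7
      linear_combination (1 / 2 : ℂ) * h7 + (1 / 2 : ℂ) * h5
    exact h4.congr_deriv h6.symm
  have hcomp : HasDerivAt (f ∘ γ) (fderiv ℝ f p v) 0 := by
    have hf' : HasFDerivAt f (fderiv ℝ f p) (γ 0) := by
      rw [hγ0]
      exact hf.hasFDerivAt
    exact hf'.comp_hasDerivAt (0 : ℝ) hγ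
  have hzero : (f ∘ γ) =ᶠ[𝓝 0] fun _ => (0 : ℂ) := by
    have ht : Tendsto γ (𝓝 0) (𝓝 p) := by
      have := hγ.continuousAt.tendsto
      rwa [hγ0] at this
    filter_upwards [ht.eventually h0] with t h
    exact h (hγM t)
  have := hzero.hasDerivAt_iff.1 hcomp
  exact this.unique (hasDerivAt_const _ _)

theorem IsTangent.lieBracket {V W : Amb → Amb} (hV : AnalyticAt ℂ V 0) (hW : AnalyticAt ℂ W 0)
    (tV : IsTangent V) (tW : IsTangent W) : IsTangent (VectorField.lieBracket ℂ V W) := by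
  unfold IsTangent at *
  filter_upwards [hV.eventually_analyticAt, hW.eventually_analyticAt, tV.eventually_nhds,
    tW.eventually_nhds] with p aV aW eV eW hp j
  have dV : DifferentiableAt ℂ V p := aV.differentiableAt
  have dW : DifferentiableAt ℂ W p := aW.differentiableAt
  have h1 : VectorField.lieBracket ℂ V W p = VectorField.lieBracket ℝ V W p := by
    simp only [VectorField.lieBracket, dV.fderiv_restrictScalars ℝ, dW.fderiv_restrictScalars ℝ]
    rfl
  have key : ∀ U : Amb → Amb, DifferentiableAt ℂ U p →
      DifferentiableAt ℝ (fun x => fderiv ℝ (rho j) x (U x)) p := by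
    intro U dU
    have h2 : DifferentiableAt ℝ (fderiv ℝ (rho j)) p :=
      (((contDiff_rho j).fderiv_right (m := 1) (by norm_num)).differentiable (by norm_num)) p
    exact h2.clm_apply (dU.restrictScalars ℝ)
  rw [h1, VectorField.fderiv_apply_lieBracket (n := 2) (contDiff_rho j).contDiffAt (by simp)
    (dW.restrictScalars ℝ) (dV.restrictScalars ℝ),
    fderiv_eq_zero_of_tangent hp (eV.self_of_nhds hp) (key W dW)
      (eW.mono fun q h hq => h hq j),
    fderiv_eq_zero_of_tangent hp (eW.self_of_nhds hp) (key V dV)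
      (eV.mono fun q h hq => h hq j), sub_zero]

/-- The real Lie algebra of infinitesimal CR-automorphisms of the second model: germs at the origin
of holomorphic vector fields `X` such that `X + conj X` is tangent to the model. -/
def autCR : LieSubalgebra ℝ HolVF where
  carrier := {X | ∃ V : Amb → Amb,
    (X : Germ (𝓝 (0 : Amb)) Amb) = (V : Germ (𝓝 (0 : Amb)) Amb) ∧ IsTangent V}
  add_mem' := by
    rintro X Y ⟨V, hV, tV⟩ ⟨W, hW, tW⟩
    refine ⟨V + W, ?_, ?_⟩
    · rw [Submodule.coe_add, hV, hW]
      rfl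
    · unfold IsTangent at *
      filter_upwards [tV, tW] with p h1 h2 hp j
      simp [h1 hp j, h2 hp j]
  zero_mem' := ⟨0, rfl, Filter.Eventually.of_forall fun p _ j => by simp⟩
  smul_mem' := by
    rintro r X ⟨V, hV, tV⟩
    refine ⟨r • V, ?_, ?_⟩
    · rw [Submodule.coe_smul, hV]
      rfl
    · unfold IsTangent at *
      filter_upwards [tV] with p h1 hp j
      simp only [Pi.smul_apply, map_smul, h1 hp j, smul_zero]
  lie_mem' := by
    rintro ⟨_, V, hV, rfl⟩ ⟨_, W, hW, rfl⟩ ⟨V', hV', tV⟩ ⟨W', hW', tW⟩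
    exact ⟨_, rfl, IsTangent.lieBracket hV hW (tV.congr (Germ.coe_eq.1 hV').symm)
      (tW.congr (Germ.coe_eq.1 hW').symm)⟩

/-! ### The explicit vector fields -/

/-- The vector field with the general coefficients `(Z, W^1, …, W^8)` depending on the twelve real
constants `c_1, …, c_8` (the entries of `t`) and `a, b, c, d`. -/
noncomputable def generalField (t : Fin 8 → ℝ) (a b c d : ℝ) (p : Amb) : Amb :=
  let z := p.1
  let w := p.2
  (c + I * d + (a + I * b) * z,
    ![t 0 + 2 * a * w 0 + 2 * (d + I * c) * z,
      t 1 + 4 * c * w 0 + 3 * a * w 1 - b * w 2 + 2 * (d + I * c) * z ^ 2,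
      t 2 + 4 * d * w 0 + b * w 1 + 3 * a * w 2 + 2 * (c - I * d) * z ^ 2,
      t 3 + 3 * c * w 1 - 3 * d * w 2 + 4 * a * w 3 - 2 * b * w 4 + 2 * (d + I * c) * z ^ 3,
      t 4 + 3 * d * w 1 + 3 * c * w 2 + 2 * b * w 3 + 4 * a * w 4 + 2 * (c - I * d) * z ^ 3,
      t 5 + 2 * c * w 1 + 2 * d * w 2 + 4 * a * w 5,
      t 6 + 2 * c * w 3 + 2 * d * w 4 + 6 * c * w 5 + 5 * a * w 6 - b * w 7,
      t 7 - 2 * d * w 3 + 2 * c * w 4 + 6 * d * w 5 + b * w 6 + 5 * a * w 7])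

/-- The vector fields `X_1, …, X_12`; here `X_i` has index `i - 1`. The first eight are
`∂_{w^1}, …, ∂_{w^8}`. -/
noncomputable def basisField : Fin 12 → Amb → Amb :=
  ![fun _ => (0, Pi.single 0 1),
    fun _ => (0, Pi.single 1 1),
    fun _ => (0, Pi.single 2 1),
    fun _ => (0, Pi.single 3 1),
    fun _ => (0, Pi.single 4 1),
    fun _ => (0, Pi.single 5 1),
    fun _ => (0, Pi.single 6 1),
    fun _ => (0, Pi.single 7 1),
    fun (z, w) => (z, ![2 * w 0, 3 * w 1, 3 * w 2, 4 * w 3, 4 * w 4, 4 * w 5, 5 * w 6, 5 * w 7]),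
    fun (z, w) => (I * z, ![0, -w 2, w 1, -2 * w 4, 2 * w 3, 0, -w 7, w 6]),
    fun (z, w) => (1, ![2 * I * z, 4 * w 0 + 2 * I * z ^ 2, 2 * z ^ 2, 3 * w 1 + 2 * I * z ^ 3,
      3 * w 2 + 2 * z ^ 3, 2 * w 1, 2 * w 3 + 6 * w 5, 2 * w 4]),
    fun (z, w) => (I, ![2 * z, 2 * z ^ 2, 4 * w 0 - 2 * I * z ^ 2, -3 * w 2 + 2 * z ^ 3,
      3 * w 1 - 2 * I * z ^ 3, 2 * w 2, 2 * w 4, -2 * w 3 + 6 * w 5])]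

/-- The pieces `g_{-5}, …, g_0` of the grading; the pieces of all other degrees are zero. -/
def gradePiece {L : Type*} [AddCommGroup L] [Module ℝ L] (X : Fin 12 → L) (k : ℤ) :
    Submodule ℝ L :=
  if k = -5 then Submodule.span ℝ {X 6, X 7}
  else if k = -4 then Submodule.span ℝ {X 3, X 4, X 5}
  else if k = -3 then Submodule.span ℝ {X 1, X 2}
  else if k = -2 then Submodule.span ℝ {X 0}
  else if k = -1 then Submodule.span ℝ {X 10, X 11}
  else if k = 0 then Submodule.span ℝ {X 8, X 9}
  else ⊥

/-- The table of commutators: the entry in row `i` and column `j`, for `i ≤ j`, is the value of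
`[X_i, X_j]`. The entries below the diagonal are not used (they are determined by antisymmetry)
and are filled with `0`. -/
def commTable {L : Type*} [AddCommGroup L] [Module ℝ L] (X : Fin 12 → L) :
    Fin 12 → Fin 12 → L :=
  let x1 := X 0
  let x2 := X 1
  let x3 := X 2
  let x4 := X 3
  let x5 := X 4
  let x6 := X 5
  let x7 := X 6
  let x8 := X 7
  let x11 := X 10
  let x12 := X 11
  let s : ℝ → L → L := fun r x => r • x
  ![![0, 0, 0, 0, 0, 0, 0, 0, s 2 x1, 0, s 4 x2, s 4 x3],
    ![0, 0, 0, 0, 0, 0, 0, 0, s 3 x2, x3, s 3 x4 + s 2 x6, s 3 x5],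
    ![0, 0, 0, 0, 0, 0, 0, 0, s 3 x3, -x2, s 3 x5, s (-3) x4 + s 2 x6],
    ![0, 0, 0, 0, 0, 0, 0, 0, s 4 x4, s 2 x5, s 2 x7, s (-2) x8],
    ![0, 0, 0, 0, 0, 0, 0, 0, s 4 x5, s (-2) x4, s 2 x8, s 2 x7],
    ![0, 0, 0, 0, 0, 0, 0, 0, s 4 x6, 0, s 6 x7, s 6 x8],
    ![0, 0, 0, 0, 0, 0, 0, 0, s 5 x7, x8, 0, 0],
    ![0, 0, 0, 0, 0, 0, 0, 0, s 5 x8, -x7, 0, 0],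
    ![0, 0, 0, 0, 0, 0, 0, 0, 0, 0, -x11, -x12],
    ![0, 0, 0, 0, 0, 0, 0, 0, 0, 0, -x12, x11],
    ![0, 0, 0, 0, 0, 0, 0, 0, 0, 0, 0, s 4 x1],
    ![0, 0, 0, 0, 0, 0, 0, 0, 0, 0, 0, 0]]

end CRModel

open CRModel

/-! Write `A_j(w) = W^j(0, w)` and `P(w) = Z(0, w)`, in code `restrW V (j - 1)` and `restrZ V`, and
let a bar stand for `conjFun`. The indices of `A_j` and `w^k` below are those of the theorem, one
more than in the code.

The model is totally real-parametrised by `z` and `Re w`, so the tangency condition is an analytic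
identity at real points. It therefore extends to an identity in independent variables `z`, `y = conj
z` and `w`, with `conj w` replaced by `w - Ξ(z, y)` (`tangency_complexified`). At `y = 0` it gives
`W^j(z, w) = A_j(w) + xi1_j(z) P̄(w)`, and at `z = 0` it shows that each `A_j` is real. Everything
is then encoded in `A_j` and `Z`, and the identity is expanded in `y` to second order.

Order one: the equations for `W^6` and `W^7` contain no `Z`. They express `P̄` through derivatives
of `A_6` and of `A_7`, while other derivatives of these functions vanish. Since partial derivatives
commute, `P̄` does not depend on `w^1, …, w^5` (`flat_conjFun_restrZ`). The equation for `W^4` then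
forces `Z = P(w) + z M(w)` (`exists_affine_Z`). Comparing powers of `z` and using that `A_j` is
real, all `∂_k A_j` with `k ≤ 5` become explicit combinations of `P, M, P̄, M̄`, and the same
commutation argument makes `M` independent of `w^1, …, w^5` (`flat_M`).

Order two: the equation for `W^4` gives `∂_k A_4 = 0` for `k = 6, 7, 8`. As `P` and `M` are
combinations of derivatives of `A_4`, both are constant. The remaining order-two equations give the
other derivatives, so every `A_j` is affine and `V` is a general field (`eq_generalField`). The
converse is a direct substitution.

The twelve real constants thus give linear coordinates on the algebra (`autOf`). The bracket is
computed once in these coordinates (`lieBracket_fieldOf`), and the basis, grading and table are read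
off from that formula. -/

namespace CRModel

/-! ### Conjugation of holomorphic maps -/

section ConjFun
variable {E F : Type*} [NormedAddCommGroup E] [NormedSpace ℂ E] [StarAddMonoid E] [StarModule ℂ E]
  [NormedStarGroup E] [NormedAddCommGroup F] [NormedSpace ℂ F] [StarAddMonoid F] [StarModule ℂ F]
  [NormedStarGroup F]

/-- The function `x ↦ conj (f (conj x))`. -/
def conjFun (f : E → F) (x : E) : F := star (f (star x))

/-- The multilinear map `x ↦ conj (φ (conj x))`. -/
noncomputable def conjMultilinear {n : ℕ} (φ : ContinuousMultilinearMap ℂ (fun _ : Fin n => E) F) :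
    ContinuousMultilinearMap ℂ (fun _ : Fin n => E) F :=
  MultilinearMap.mkContinuous
    { toFun := fun x => star (φ fun i => star (x i))
      map_update_add' := by
        intro inst x i a b
        have h : ∀ v : E, (fun k => star (Function.update x i v k))
            = Function.update (fun k => star (x k)) i (star v) := by
          intro v
          funext k
          by_cases hk : k = i
          · subst hk; simp
          · simp [hk]
        rw [h, h, h, star_add, ContinuousMultilinearMap.map_update_add, star_add]
      map_update_smul' := by
        intro inst x i c a
        have h : ∀ v : E, (fun k => star (Function.update x i v k))
            = Function.update (fun k => star (x k)) i (star v) := by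
          intro v
          funext k
          by_cases hk : k = i
          · subst hk; simp
          · simp [hk]
        rw [h, h, star_smul, ContinuousMultilinearMap.map_update_smul, star_smul, star_star] }
    ‖φ‖ (by
      intro x
      have := φ.le_opNorm fun i => star (x i)
      simpa using this)

theorem conjMultilinear_apply {n : ℕ} (φ : ContinuousMultilinearMap ℂ (fun _ : Fin n => E) F)
    (x : Fin n → E) : conjMultilinear φ x = star (φ fun i => star (x i)) := rfl

theorem norm_conjMultilinear_le {n : ℕ} (φ : ContinuousMultilinearMap ℂ (fun _ : Fin n => E) F) :
    ‖conjMultilinear φ‖ ≤ ‖φ‖ :=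
  MultilinearMap.mkContinuous_norm_le _ (norm_nonneg _) _

/-- Conjugating the coefficients of the power series of `f` does not increase their norms, so the
conjugate series converges at least on the same ball. -/
theorem analyticAt_conjFun {f : E → F} {x : E} (hf : AnalyticAt ℂ f (star x)) :
    AnalyticAt ℂ (conjFun f) x := by
  obtain ⟨p, r, hp⟩ := hf
  refine ⟨fun n => conjMultilinear (p n), r, ?_, hp.r_pos, ?_⟩
  · refine hp.r_le.trans (ENNReal.le_of_forall_nnreal_lt fun s hs => ?_)
    obtain ⟨C, -, hC⟩ := p.norm_mul_pow_le_of_lt_radius hs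
    refine FormalMultilinearSeries.le_radius_of_bound _ C fun n => le_trans ?_ (hC n)
    exact mul_le_mul_of_nonneg_right (norm_conjMultilinear_le _) (by positivity)
  · intro y hy
    have h1 : star y ∈ Metric.eball (0 : E) r := by
      simpa [Metric.mem_eball, edist_zero_right, enorm, nnnorm_star] using hy
    have h2 := (hp.hasSum h1).star
    simpa [CRModel.conjFun, conjMultilinear_apply] using h2

end ConjFun

theorem eventually_star {E : Type*} [NormedAddCommGroup E] [StarAddMonoid E] [NormedStarGroup E]
    {P : E → Prop} (h : ∀ᶠ x in 𝓝 0, P x) : ∀ᶠ x in 𝓝 0, P (star x) := by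
  have : Tendsto (star : E → E) (𝓝 0) (𝓝 0) := by
    simpa using (continuous_star (R := E)).tendsto 0
  exact this.eventually h


/-! ### Uniqueness from real points -/

/-- The points of `ℂ × ℂ × ℂ^8` with real coordinates. -/
def realPt (x y : ℝ) (u : Fin 8 → ℝ) : ℂ × ℂ × (Fin 8 → ℂ) := (x, y, fun j => (u j : ℂ))

theorem norm_realPt_re_le (v : ℂ × ℂ × (Fin 8 → ℂ)) :
    ‖realPt v.1.re v.2.1.re fun j => (v.2.2 j).re‖ ≤ ‖v‖ := by
  refine norm_prod_le_iff.2 ⟨?_, norm_prod_le_iff.2 ⟨?_, (pi_norm_le_iff_of_nonneg (norm_nonneg _)).2 fun j => ?_⟩⟩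
  · simpa [realPt] using (Complex.abs_re_le_norm v.1).trans (norm_fst_le v)
  · simpa [realPt] using (Complex.abs_re_le_norm v.2.1).trans ((norm_fst_le v.2).trans (norm_snd_le v))
  · simpa [realPt] using (Complex.abs_re_le_norm (v.2.2 j)).trans
      ((norm_le_pi_norm v.2.2 j).trans ((norm_snd_le v.2).trans (norm_snd_le v)))

theorem norm_realPt_im_le (v : ℂ × ℂ × (Fin 8 → ℂ)) :
    ‖realPt v.1.im v.2.1.im fun j => (v.2.2 j).im‖ ≤ ‖v‖ := by
  refine norm_prod_le_iff.2 ⟨?_, norm_prod_le_iff.2 ⟨?_, (pi_norm_le_iff_of_nonneg (norm_nonneg _)).2 fun j => ?_⟩⟩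
  · simpa [realPt] using (Complex.abs_im_le_norm v.1).trans (norm_fst_le v)
  · simpa [realPt] using (Complex.abs_im_le_norm v.2.1).trans ((norm_fst_le v.2).trans (norm_snd_le v))
  · simpa [realPt] using (Complex.abs_im_le_norm (v.2.2 j)).trans
      ((norm_le_pi_norm v.2.2 j).trans ((norm_snd_le v.2).trans (norm_snd_le v)))

/-- A holomorphic function that vanishes at the real points near the origin vanishes near the
origin. -/
theorem eventually_eq_zero_of_real {f : ℂ × ℂ × (Fin 8 → ℂ) → ℂ} (hf : AnalyticAt ℂ f 0)
    (h0 : ∀ᶠ v in 𝓝 0, ∀ x y u, v = realPt x y u → f v = 0) : ∀ᶠ v in 𝓝 0, f v = 0 := by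
  obtain ⟨R, hR, hball⟩ := Metric.eventually_nhds_iff_ball.1 (hf.eventually_analyticAt.and h0)
  -- Write `v = a + i b` with `a`, `b` real points. The radius `R / 3` keeps `a + t b` in the ball
  -- of radius `R` for `|t| < 2`. This disc contains the real `t`, where `f` vanishes, as well as `t
  -- = i`, so the one-variable identity theorem applies.
  refine Metric.eventually_nhds_iff_ball.2 ⟨R / 3, by positivity, fun v hv => ?_⟩
  set a := realPt v.1.re v.2.1.re fun j => (v.2.2 j).re with ha
  set b := realPt v.1.im v.2.1.im fun j => (v.2.2 j).im with hb
  have hv' : ‖v‖ < R / 3 := by simpa using hv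
  have na : ‖a‖ < R / 3 := (norm_realPt_re_le v).trans_lt hv'
  have nb : ‖b‖ < R / 3 := (norm_realPt_im_le v).trans_lt hv'
  have hvab : v = a + I • b := by
    refine Prod.ext ?_ (Prod.ext ?_ (funext fun j => ?_)) <;>
    · simp only [ha, hb, realPt, Prod.fst_add, Prod.snd_add, Prod.smul_fst, Prod.smul_snd,
        Pi.add_apply, Pi.smul_apply, smul_eq_mul]
      rw [mul_comm]
      exact (Complex.re_add_im _).symm
  have hmem : ∀ t ∈ Metric.ball (0 : ℂ) 2, a + t • b ∈ Metric.ball (0 : ℂ × ℂ × (Fin 8 → ℂ)) R := by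
    intro t ht
    have h1 : ‖t‖ < 2 := by simpa using ht
    have h2 : ‖a + t • b‖ ≤ ‖a‖ + ‖t‖ * ‖b‖ := (norm_add_le _ _).trans_eq (by rw [norm_smul])
    have h3 : ‖t‖ * ‖b‖ ≤ 2 * ‖b‖ := mul_le_mul_of_nonneg_right h1.le (norm_nonneg _)
    simp only [mem_ball_zero_iff]
    linarith
  have hg : AnalyticOnNhd ℂ (fun t : ℂ => f (a + t • b)) (Metric.ball 0 2) := by
    intro t ht
    have h1 : AnalyticAt ℂ (fun t : ℂ => a + t • b) t := by fun_prop
    exact (hball _ (hmem t ht)).1.fun_comp_of_eq h1 rfl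
  have hfreq : ∃ᶠ t in 𝓝[≠] (0 : ℂ), f (a + t • b) = 0 := by
    have h1 : Tendsto (fun s : ℝ => (s : ℂ)) (𝓝[≠] 0) (𝓝[≠] 0) := by
      refine tendsto_nhdsWithin_iff.2 ⟨?_, ?_⟩
      · have := Complex.continuous_ofReal.tendsto 0
        simp only [ofReal_zero] at this
        exact this.mono_left nhdsWithin_le_nhds
      · filter_upwards [self_mem_nhdsWithin] with s hs
        simpa using hs
    refine h1.frequently (Filter.Eventually.frequently ?_)
    have h2 : ∀ᶠ s : ℝ in 𝓝[≠] 0, (s : ℂ) ∈ Metric.ball (0 : ℂ) 2 :=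
      (h1.mono_right nhdsWithin_le_nhds).eventually (Metric.ball_mem_nhds 0 (by norm_num))
    filter_upwards [h2] with s hs
    refine (hball _ (hmem _ hs)).2 (v.1.re + s * v.1.im) (v.2.1.re + s * v.2.1.im)
      (fun j => (v.2.2 j).re + s * (v.2.2 j).im) ?_
    refine Prod.ext ?_ (Prod.ext ?_ (funext fun j => ?_)) <;> simp [ha, hb, realPt]
  have := hg.eqOn_zero_of_preconnected_of_frequently_eq_zero
    (convex_ball (0 : ℂ) 2).isPreconnected (Metric.mem_ball_self (by norm_num)) hfreq
    (show I ∈ Metric.ball (0 : ℂ) 2 by simp)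
  rw [hvab]
  exact this

/-! ### Second-order jets of functions of one variable -/

/-- `φ t = a + b t + c t² + o(t²)` as `t → 0`. -/
def HasJet (φ : ℂ → ℂ) (a b c : ℂ) : Prop :=
  ∃ ψ : ℂ → ℂ, ContinuousAt ψ 0 ∧ ψ 0 = c ∧ ∀ᶠ t in 𝓝 0, φ t = a + b * t + ψ t * t ^ 2

/-- Evaluate at `0`, divide by `t` away from `0`, and recover `G 0` by continuity. Iterated, this
reads off coefficients from the left. Since `G` need only be continuous, it also applies when an
unknown function such as `Z(·, w)` occurs inside `G`. -/
theorem eq_zero_of_add_mul_eq_zero {c : ℂ} {G : ℂ → ℂ} (hG : ContinuousAt G 0)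
    (h : ∀ᶠ t in 𝓝 0, c + t * G t = 0) : c = 0 ∧ G 0 = 0 ∧ ∀ᶠ t in 𝓝 0, G t = 0 := by
  have hc : c = 0 := by simpa using h.self_of_nhds
  subst hc
  have h1 : ∀ᶠ t in 𝓝[≠] 0, G t = 0 := by
    filter_upwards [h.filter_mono nhdsWithin_le_nhds, self_mem_nhdsWithin] with t ht hne
    simpa [show t ≠ 0 from hne] using ht
  have h2 : G 0 = 0 :=
    tendsto_nhds_unique (hG.tendsto.mono_left nhdsWithin_le_nhds)
      (tendsto_const_nhds.congr' (h1.mono fun t ht => ht.symm))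
  refine ⟨rfl, h2, ?_⟩
  filter_upwards [eventually_nhdsWithin_iff.1 h1] with t ht
  by_cases h0 : t = 0
  · rw [h0, h2]
  · exact ht h0

theorem eq_zero_of_poly_eq_zero {c0 c1 c2 c3 c4 c5 c6 : ℂ}
    (h : ∀ᶠ t : ℂ in 𝓝 0,
      c0 + c1 * t + c2 * t ^ 2 + c3 * t ^ 3 + c4 * t ^ 4 + c5 * t ^ 5 + c6 * t ^ 6 = 0) :
    c0 = 0 ∧ c1 = 0 ∧ c2 = 0 ∧ c3 = 0 ∧ c4 = 0 ∧ c5 = 0 ∧ c6 = 0 := by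
  obtain ⟨h0, -, h⟩ := eq_zero_of_add_mul_eq_zero (c := c0)
    (G := fun t => c1 + t * (c2 + t * (c3 + t * (c4 + t * (c5 + t * c6))))) (by fun_prop)
    (h.mono fun t ht => by linear_combination ht)
  obtain ⟨h1, -, h⟩ := eq_zero_of_add_mul_eq_zero (by fun_prop) h
  obtain ⟨h2, -, h⟩ := eq_zero_of_add_mul_eq_zero (by fun_prop) h
  obtain ⟨h3, -, h⟩ := eq_zero_of_add_mul_eq_zero (by fun_prop) h
  obtain ⟨h4, -, h⟩ := eq_zero_of_add_mul_eq_zero (by fun_prop) h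
  obtain ⟨h5, h6, -⟩ := eq_zero_of_add_mul_eq_zero (by fun_prop) h
  exact ⟨h0, h1, h2, h3, h4, h5, h6⟩

namespace HasJet

variable {φ χ : ℂ → ℂ} {a b c a' b' c' : ℂ}

theorem add (h : HasJet φ a b c) (h' : HasJet χ a' b' c') :
    HasJet (fun t => φ t + χ t) (a + a') (b + b') (c + c') := by
  obtain ⟨ψ, hψ, h0, h⟩ := h
  obtain ⟨ψ', hψ', h0', h'⟩ := h'
  refine ⟨fun t => ψ t + ψ' t, by fun_prop, by simp [h0, h0'], ?_⟩
  filter_upwards [h, h'] with t ht ht'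
  rw [ht, ht']
  ring

theorem sub (h : HasJet φ a b c) (h' : HasJet χ a' b' c') :
    HasJet (fun t => φ t - χ t) (a - a') (b - b') (c - c') := by
  obtain ⟨ψ, hψ, h0, h⟩ := h
  obtain ⟨ψ', hψ', h0', h'⟩ := h'
  refine ⟨fun t => ψ t - ψ' t, by fun_prop, by simp [h0, h0'], ?_⟩
  filter_upwards [h, h'] with t ht ht'
  rw [ht, ht']
  ring

theorem mul (h : HasJet φ a b c) (h' : HasJet χ a' b' c') :
    HasJet (fun t => φ t * χ t) (a * a') (a * b' + b * a') (a * c' + b * b' + c * a') := by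
  obtain ⟨ψ, hψ, h0, h⟩ := h
  obtain ⟨ψ', hψ', h0', h'⟩ := h'
  refine ⟨fun t => a * ψ' t + b * b' + ψ t * a' + t * (b * ψ' t + ψ t * b') + t ^ 2 * ψ t * ψ' t,
    by fun_prop, by simp [h0, h0'], ?_⟩
  filter_upwards [h, h'] with t ht ht'
  rw [ht, ht']
  ring

theorem const (a : ℂ) : HasJet (fun _ => a) a 0 0 :=
  ⟨fun _ => 0, by fun_prop, rfl, .of_forall fun t => by ring⟩

theorem id : HasJet (fun t => t) 0 1 0 :=
  ⟨fun _ => 0, by fun_prop, rfl, .of_forall fun t => by ring⟩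

theorem unique (h : HasJet φ a b c) (h' : HasJet χ a' b' c') (he : ∀ᶠ t in 𝓝 0, φ t = χ t) :
    a = a' ∧ b = b' ∧ c = c' := by
  obtain ⟨ψ, hψ, h0, h⟩ := h
  obtain ⟨ψ', hψ', h0', h'⟩ := h'
  obtain ⟨h1, -, h2⟩ := eq_zero_of_add_mul_eq_zero (c := a - a')
    (G := fun t => b - b' + t * (ψ t - ψ' t)) (by fun_prop) (by
      filter_upwards [h, h', he] with t e1 e2 e3
      linear_combination e3 - e1 + e2)
  obtain ⟨h3, h4, -⟩ := eq_zero_of_add_mul_eq_zero (by fun_prop) h2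
  exact ⟨sub_eq_zero.1 h1, sub_eq_zero.1 h3, by rw [← h0, ← h0']; exact sub_eq_zero.1 h4⟩

/-- The factor of `t ^ 2` is the twice iterated difference quotient `dslope`. It is analytic at `0`,
and its value there is the second Taylor coefficient. -/
theorem of_analyticAt (h : AnalyticAt ℂ φ 0) :
    HasJet φ (φ 0) (deriv φ 0) (deriv (deriv φ) 0 / 2) := by
  have hp := h.hasFPowerSeriesAt
  have h2 := hp.has_fpower_series_iterate_dslope_fslope 2
  refine ⟨_, h2.continuousAt, ?_, .of_forall fun t => ?_⟩
  · have h4 : (FormalMultilinearSeries.fslope^[2]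
        (FormalMultilinearSeries.ofScalars ℂ fun n => iteratedDeriv n φ 0 / n.factorial)).coeff 0
        = iteratedDeriv 2 φ 0 / (Nat.factorial 2) := by
      rw [FormalMultilinearSeries.coeff_iterate_fslope, FormalMultilinearSeries.coeff_ofScalars]
    rw [← h2.coeff_zero (fun i => (1 : Fin 0 → ℂ) i)]
    have h5 : iteratedDeriv 2 φ 0 = deriv (deriv φ) 0 := by
      rw [iteratedDeriv_succ, iteratedDeriv_one]
    rw [h5] at h4
    exact h4.trans (by norm_num)
  · have e1 := sub_smul_dslope φ 0 t
    have e2 := sub_smul_dslope (dslope φ 0) 0 t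
    simp only [Function.iterate_succ, Function.iterate_zero, Function.comp_apply, id_eq,
      Function.swap, smul_eq_mul, dslope_same, sub_zero] at *
    linear_combination -e1 - t * e2

end HasJet

/-! ### Partial derivatives of functions of `w` -/

/-- The partial derivative with respect to the `k`-th coordinate. -/
noncomputable def pd (k : Fin 8) (g : (Fin 8 → ℂ) → ℂ) (w : Fin 8 → ℂ) : ℂ :=
  fderiv ℂ g w (Pi.single k 1)

theorem fderiv_eq_sum_pd (g : (Fin 8 → ℂ) → ℂ) (w v : Fin 8 → ℂ) :
    fderiv ℂ g w v = ∑ k, v k * pd k g w := by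
  have := LinearMap.pi_apply_eq_sum_univ (fderiv ℂ g w).toLinearMap v
  simp only [ContinuousLinearMap.coe_coe, smul_eq_mul] at this
  rw [this]
  refine Finset.sum_congr rfl fun k _ => ?_
  simp only [pd]
  congr 2
  funext i
  simp [Pi.single_apply, eq_comm]

theorem analyticAt_pd {g : (Fin 8 → ℂ) → ℂ} {w : Fin 8 → ℂ} (hg : AnalyticAt ℂ g w) (k : Fin 8) :
    AnalyticAt ℂ (pd k g) w :=
  (ContinuousLinearMap.apply ℂ ℂ (Pi.single k (1 : ℂ) : Fin 8 → ℂ)).analyticAt _ |>.comp hg.fderiv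

theorem hasDerivAt_comp_sub {g : (Fin 8 → ℂ) → ℂ} {w : Fin 8 → ℂ} {h : ℂ → Fin 8 → ℂ} {t : ℂ}
    {h' : Fin 8 → ℂ} (hg : DifferentiableAt ℂ g (w - h t))
    (hh : ∀ k, HasDerivAt (fun s => h s k) (h' k) t) :
    HasDerivAt (fun s => g (w - h s)) (-∑ k, h' k * pd k g (w - h t)) t := by
  have h1 : HasDerivAt (fun s => w - h s) (-h') t := (hasDerivAt_pi.2 hh).const_sub w
  have h2 := hg.hasFDerivAt.comp_hasDerivAt t h1
  rw [fderiv_eq_sum_pd] at h2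
  refine h2.congr_deriv ?_
  simp [Finset.sum_neg_distrib]

theorem pd_comm {g : (Fin 8 → ℂ) → ℂ} {w : Fin 8 → ℂ} (hg : AnalyticAt ℂ g w) (k l : Fin 8) :
    pd k (pd l g) w = pd l (pd k g) w := by
  have hs : IsSymmSndFDerivAt ℂ g w := hg.contDiffAt.isSymmSndFDerivAt (n := ⊤) (by simp)
  have h1 : ∀ a b : Fin 8, pd a (pd b g) w
      = fderiv ℂ (fderiv ℂ g) w (Pi.single a 1) (Pi.single b 1) := by
    intro a b
    have : HasFDerivAt (pd b g) _ w :=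
      (hg.fderiv.differentiableAt.hasFDerivAt).clm_apply (hasFDerivAt_const (Pi.single b (1 : ℂ) : Fin 8 → ℂ) w)
    rw [pd, this.fderiv]
    simp
  rw [h1, h1]
  exact hs.eq _ _

theorem pd_congr {f g : (Fin 8 → ℂ) → ℂ} (h : f =ᶠ[𝓝 0] g) (k : Fin 8) :
    pd k f =ᶠ[𝓝 0] pd k g :=
  (h.fderiv (𝕜 := ℂ)).mono fun w hw => by simp only [pd, hw]

theorem pd_conjFun {g : (Fin 8 → ℂ) → ℂ} (k : Fin 8) (w : Fin 8 → ℂ)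
    (hg : AnalyticAt ℂ g (star w)) : pd k (conjFun g) w = star (pd k g (star w)) := by
  have h1 := hg.differentiableAt.hasFDerivAt.star_star
  rw [star_star] at h1
  rw [pd, show conjFun g = star ∘ g ∘ star from rfl, h1.fderiv]
  simp [pd]

/-- The second-order chain rule along the curve `w - h(s)`, which starts at `w`. It is used with `h
= Ξ(z, ·)`, to expand functions of `conj w` in the conjugate variable. -/
theorem HasJet.comp_sub {g : (Fin 8 → ℂ) → ℂ} {w : Fin 8 → ℂ} {h : ℂ → Fin 8 → ℂ}
    {e f : Fin 8 → ℂ} (hg : AnalyticAt ℂ g w) (hh : ∀ k, AnalyticAt ℂ (fun s => h s k) 0)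
    (hj : ∀ k, HasJet (fun s => h s k) 0 (e k) (f k)) :
    HasJet (fun s => g (w - h s)) (g w) (-∑ k, e k * pd k g w)
      (-∑ k, f k * pd k g w + (∑ k, e k * ∑ l, e l * pd l (pd k g) w) / 2) := by
  have hu := fun k => (HasJet.of_analyticAt (hh k)).unique (hj k) (.of_forall fun _ => rfl)
  have h0 : h 0 = 0 := funext fun k => (hu k).1
  have hhan : AnalyticAt ℂ h 0 := analyticAt_pi_iff.2 hh
  have hsub : AnalyticAt ℂ (fun s => w - h s) 0 := analyticAt_const.sub hhan
  have hφ : AnalyticAt ℂ (fun s => g (w - h s)) 0 := by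
    refine AnalyticAt.fun_comp (by simpa [h0] using hg) hsub
  have hd : ∀ g' : (Fin 8 → ℂ) → ℂ, AnalyticAt ℂ g' w → ∀ᶠ s in 𝓝 0,
      HasDerivAt (fun s => g' (w - h s))
        (-∑ k, deriv (fun s => h s k) s * pd k g' (w - h s)) s := by
    intro g' hg'
    have h1 : ∀ᶠ s in 𝓝 0, AnalyticAt ℂ g' (w - h s) :=
      hsub.continuousAt.eventually (by simpa [h0] using hg'.eventually_analyticAt)
    filter_upwards [h1, hhan.eventually_analyticAt] with s h1 h2
    exact hasDerivAt_comp_sub h1.differentiableAt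
      fun k => (analyticAt_pi_iff.1 h2 k).differentiableAt.hasDerivAt
  -- Stated for arbitrary `g'`, because it is needed for `g` and, for the second derivative, for
  -- each `pd k g`.
  have key : ∀ g' : (Fin 8 → ℂ) → ℂ, AnalyticAt ℂ g' w →
      HasDerivAt (fun s => g' (w - h s)) (-∑ k, e k * pd k g' w) 0 := by
    intro g' hg'
    have := (hd g' hg').self_of_nhds
    simpa [h0, (hu _).2.1] using this
  have h2 : HasDerivAt (fun s => -∑ k, deriv (fun s => h s k) s * pd k g (w - h s))
      (-∑ k, (deriv (deriv (fun s => h s k)) 0 * pd k g w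
        + e k * (-∑ l, e l * pd l (pd k g) w))) 0 := by
    have h3 := (HasDerivAt.fun_sum (u := Finset.univ) fun k _ =>
      ((hh k).deriv.differentiableAt.hasDerivAt).mul (key _ (analyticAt_pd hg k))).neg
    simp only [h0, (hu _).2.1, sub_zero] at h3
    exact h3
  have h3 : deriv (fun s => g (w - h s)) =ᶠ[𝓝 0]
      fun s => -∑ k, deriv (fun s => h s k) s * pd k g (w - h s) :=
    (hd g hg).mono fun s hs => hs.deriv
  have hJ := HasJet.of_analyticAt hφ
  have e2 : deriv (deriv (fun s => g (w - h s))) 0 / 2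
      = -∑ k, f k * pd k g w + (∑ k, e k * ∑ l, e l * pd l (pd k g) w) / 2 := by
    rw [h3.deriv_eq, h2.deriv]
    have : ∀ k, deriv (deriv (fun s => h s k)) 0 = 2 * f k := fun k => by
      rw [← (hu k).2.2]; ring
    simp only [this, Finset.sum_add_distrib, mul_neg, Finset.sum_neg_distrib, mul_assoc,
      ← Finset.mul_sum]
    ring
  rw [e2, (key g hg).deriv] at hJ
  simpa [h0] using hJ

/-! ### The complexified tangency equation -/

/-- The polarisation of the right-hand sides `Ξ_j`: `conj z` is replaced by an independent
variable. -/
noncomputable def XiP (z y : ℂ) : Fin 8 → ℂ :=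
  ![2 * I * (z * y),
    2 * I * (z ^ 2 * y + z * y ^ 2),
    2 * (z ^ 2 * y - z * y ^ 2),
    2 * I * (z ^ 3 * y + z * y ^ 3),
    2 * (z ^ 3 * y - z * y ^ 3),
    2 * I * (z ^ 2 * y ^ 2),
    2 * I * (z ^ 3 * y ^ 2 + z ^ 2 * y ^ 3),
    2 * (z ^ 3 * y ^ 2 - z ^ 2 * y ^ 3)]

/-- The partial derivatives of `XiP` in the first variable. -/
noncomputable def XiZ (z y : ℂ) : Fin 8 → ℂ :=
  ![2 * I * y,
    2 * I * (2 * z * y + y ^ 2),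
    2 * (2 * z * y - y ^ 2),
    2 * I * (3 * z ^ 2 * y + y ^ 3),
    2 * (3 * z ^ 2 * y - y ^ 3),
    2 * I * (2 * z * y ^ 2),
    2 * I * (3 * z ^ 2 * y ^ 2 + 2 * z * y ^ 3),
    2 * (3 * z ^ 2 * y ^ 2 - 2 * z * y ^ 3)]

/-- The partial derivatives of `XiP` in the second variable. -/
noncomputable def XiY (z y : ℂ) : Fin 8 → ℂ :=
  ![2 * I * z,
    2 * I * (z ^ 2 + 2 * z * y),
    2 * (z ^ 2 - 2 * z * y),
    2 * I * (z ^ 3 + 3 * z * y ^ 2),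
    2 * (z ^ 3 - 3 * z * y ^ 2),
    2 * I * (2 * z ^ 2 * y),
    2 * I * (2 * z ^ 3 * y + 3 * z ^ 2 * y ^ 2),
    2 * (2 * z ^ 3 * y - 3 * z ^ 2 * y ^ 2)]

theorem hasDerivAt_XiP {a b : ℝ → ℂ} {a' b' : ℂ} {t : ℝ}
    (ha : HasDerivAt a a' t) (hb : HasDerivAt b b' t) (j : Fin 8) :
    HasDerivAt (fun s => XiP (a s) (b s) j)
      (XiZ (a t) (b t) j * a' + XiY (a t) (b t) j * b') t := by
  fin_cases j
  · refine ((ha.mul hb).const_mul (2 * I)).congr_deriv ?_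
    simp [XiZ, XiY]
    ring
  · refine ((((ha.pow 2).mul hb).add (ha.mul (hb.pow 2))).const_mul (2 * I)).congr_deriv ?_
    simp [XiZ, XiY]
    ring
  · refine ((((ha.pow 2).mul hb).sub (ha.mul (hb.pow 2))).const_mul 2).congr_deriv ?_
    simp [XiZ, XiY]
    ring
  · refine ((((ha.pow 3).mul hb).add (ha.mul (hb.pow 3))).const_mul (2 * I)).congr_deriv ?_
    simp [XiZ, XiY]
    ring
  · refine ((((ha.pow 3).mul hb).sub (ha.mul (hb.pow 3))).const_mul 2).congr_deriv ?_
    simp [XiZ, XiY]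
    ring
  · refine (((ha.pow 2).mul (hb.pow 2)).const_mul (2 * I)).congr_deriv ?_
    simp [XiZ, XiY]
    ring
  · refine ((((ha.pow 3).mul (hb.pow 2)).add ((ha.pow 2).mul (hb.pow 3))).const_mul
      (2 * I)).congr_deriv ?_
    simp [XiZ, XiY]
    ring
  · refine ((((ha.pow 3).mul (hb.pow 2)).sub ((ha.pow 2).mul (hb.pow 3))).const_mul
      2).congr_deriv ?_
    simp [XiZ, XiY]
    ring

/-- The real differential split into its `z` and `conj z` parts: `Ξ` is the polarisation on the
antidiagonal, differentiated along a real line and its conjugate. -/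
theorem fderiv_Xi (z v : ℂ) (j : Fin 8) : fderiv ℝ (fun z => Xi z j) z v
    = XiZ z (starRingEnd ℂ z) j * v + XiY z (starRingEnd ℂ z) j * starRingEnd ℂ v := by
  have hline : HasDerivAt (fun t : ℝ => z + t • v) v 0 := by
    simpa using ((hasDerivAt_id (0 : ℝ)).smul_const v).const_add z
  have hconj : HasDerivAt (fun t : ℝ => starRingEnd ℂ (z + t • v)) (starRingEnd ℂ v) 0 :=
    (conjCLE : ℂ ≃L[ℝ] ℂ).hasFDerivAt.comp_hasDerivAt (0 : ℝ) hline
  have h1 := hasDerivAt_XiP hline hconj j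
  have h2 : HasFDerivAt (fun z => Xi z j) (fderiv ℝ (fun z => Xi z j) z) (z + (0 : ℝ) • v) := by
    simpa using (((contDiff_Xi j).differentiable (by norm_num)) z).hasFDerivAt
  have h3 : HasDerivAt ((fun z => Xi z j) ∘ fun s : ℝ => z + s • v)
      (fderiv ℝ (fun z => Xi z j) z v) 0 :=
    h2.comp_hasDerivAt (0 : ℝ) hline
  have h4 : HasDerivAt ((fun z => Xi z j) ∘ fun s : ℝ => z + s • v) _ 0 := h1
  simpa using h3.unique h4

theorem fderiv_rho_eq (j : Fin 8) (p v : Amb) : fderiv ℝ (rho j) p v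
    = v.2 j - star (v.2 j) - (XiZ p.1 (star p.1) j * v.1 + XiY p.1 (star p.1) j * star v.1) := by
  rw [fderiv_rho, fderiv_Xi]
  rfl

theorem XiP_zero_left (y : ℂ) : XiP 0 y = 0 := by
  funext j
  fin_cases j <;> simp [XiP]

theorem XiP_zero_right (z : ℂ) : XiP z 0 = 0 := by
  funext j
  fin_cases j <;> simp [XiP]

section
variable {E : Type*} [NormedAddCommGroup E] [NormedSpace ℂ E] {a b : E → ℂ} {x : E}

theorem analyticAt_XiP (ha : AnalyticAt ℂ a x) (hb : AnalyticAt ℂ b x) (j : Fin 8) :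
    AnalyticAt ℂ (fun s => XiP (a s) (b s) j) x := by
  fin_cases j <;> simp [XiP] <;> fun_prop

theorem analyticAt_XiZ (ha : AnalyticAt ℂ a x) (hb : AnalyticAt ℂ b x) (j : Fin 8) :
    AnalyticAt ℂ (fun s => XiZ (a s) (b s) j) x := by
  fin_cases j <;> simp [XiZ] <;> fun_prop

theorem analyticAt_XiY (ha : AnalyticAt ℂ a x) (hb : AnalyticAt ℂ b x) (j : Fin 8) :
    AnalyticAt ℂ (fun s => XiY (a s) (b s) j) x := by
  fin_cases j <;> simp [XiY] <;> fun_prop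

theorem analyticAt_vec_XiP (ha : AnalyticAt ℂ a x) (hb : AnalyticAt ℂ b x) :
    AnalyticAt ℂ (fun s => XiP (a s) (b s)) x :=
  analyticAt_pi_iff.2 (analyticAt_XiP ha hb)

end

theorem star_XiP (z : ℂ) (j : Fin 8) : star (XiP z (star z) j) = - XiP z (star z) j :=
  conj_Xi z j

theorem tangency_complexified {V : Amb → Amb} (hV : AnalyticAt ℂ V 0) (tV : IsTangent V) :
    ∀ᶠ q : ℂ × ℂ × (Fin 8 → ℂ) in 𝓝 0, ∀ j,
      (V (q.1, q.2.2)).2 j - (conjFun V (q.2.1, q.2.2 - XiP q.1 q.2.1)).2 j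
        = XiZ q.1 q.2.1 j * (V (q.1, q.2.2)).1
          + XiY q.1 q.2.1 j * (conjFun V (q.2.1, q.2.2 - XiP q.1 q.2.1)).1 := by
  rw [eventually_all]
  intro j
  -- the real parametrisation of the model, extended to complex parameters
  let z : ℂ × ℂ × (Fin 8 → ℂ) → ℂ := fun s => s.1 + I * s.2.1
  let y : ℂ × ℂ × (Fin 8 → ℂ) → ℂ := fun s => s.1 - I * s.2.1
  let a : ℂ × ℂ × (Fin 8 → ℂ) → Amb := fun s => (z s, s.2.2 + (1 / 2 : ℂ) • XiP (z s) (y s))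
  let b : ℂ × ℂ × (Fin 8 → ℂ) → Amb := fun s => (y s, s.2.2 - (1 / 2 : ℂ) • XiP (z s) (y s))
  have hz : AnalyticAt ℂ z 0 :=
    analyticAt_fst.add (analyticAt_const.mul (analyticAt_fst.comp analyticAt_snd))
  have hy : AnalyticAt ℂ y 0 :=
    analyticAt_fst.sub (analyticAt_const.mul (analyticAt_fst.comp analyticAt_snd))
  have hX : AnalyticAt ℂ (fun s => XiP (z s) (y s)) 0 := analyticAt_vec_XiP hz hy
  have hX2 : AnalyticAt ℂ (fun s => (1 / 2 : ℂ) • XiP (z s) (y s)) 0 := hX.fun_const_smul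
  have ha : AnalyticAt ℂ a 0 := hz.prod ((analyticAt_snd.comp analyticAt_snd).add hX2)
  have hb : AnalyticAt ℂ b 0 := hy.prod ((analyticAt_snd.comp analyticAt_snd).sub hX2)
  have ha0 : a 0 = 0 := by simp [a, z, y, XiP_zero_left]
  have hb0 : b 0 = 0 := by simp [b, z, y, XiP_zero_left]
  have hVa : AnalyticAt ℂ (fun s => V (a s)) 0 := AnalyticAt.fun_comp (by rwa [ha0]) ha
  have hVb : AnalyticAt ℂ (fun s => conjFun V (b s)) 0 :=
    AnalyticAt.fun_comp (analyticAt_conjFun (by rwa [hb0, star_zero])) hb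
  have hproj : ∀ {U : ℂ × ℂ × (Fin 8 → ℂ) → Amb}, AnalyticAt ℂ U 0 →
      AnalyticAt ℂ (fun s => (U s).2 j) 0 := fun hU =>
    analyticAt_pi_iff.1 (analyticAt_snd.comp hU) j
  let G : ℂ × ℂ × (Fin 8 → ℂ) → ℂ := fun s => (V (a s)).2 j - (conjFun V (b s)).2 j
    - (XiZ (z s) (y s) j * (V (a s)).1 + XiY (z s) (y s) j * (conjFun V (b s)).1)
  have hG : AnalyticAt ℂ G 0 := ((hproj hVa).sub (hproj hVb)).sub
    (((analyticAt_XiZ hz hy j).mul (analyticAt_fst.comp hVa)).add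
      ((analyticAt_XiY hz hy j).mul (analyticAt_fst.comp hVb)))
  have hG0 : ∀ᶠ s in 𝓝 0, G s = 0 := by
    refine eventually_eq_zero_of_real hG ?_
    have hta : Tendsto a (𝓝 0) (𝓝 0) := by simpa [ha0] using ha.continuousAt.tendsto
    filter_upwards [hta.eventually tV] with s hs x' y' u hsu
    -- For real parameters the two arguments `a s` and `b s` are conjugate and `a s` lies on the
    -- model, so `G s = 0` is the tangency condition at `a s`.
    have hys : y s = star (z s) := by simp [hsu, y, z, realPt]; ring
    have hbs : b s = star (a s) := by
      refine Prod.ext hys (funext fun k => ?_)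
      have h1 := star_XiP (z s) k
      simp only [b, a, Prod.snd_star, Pi.star_apply, Pi.sub_apply, Pi.add_apply, Pi.smul_apply,
        star_add, smul_eq_mul, star_mul', hys, h1]
      simp [hsu, realPt]
      ring
    have hmem : a s ∈ secondModel := by
      intro k
      have h1 : star ((a s).2 k) = (b s).2 k := by rw [hbs]; rfl
      have h2 : rho k (a s) = (a s).2 k - star ((a s).2 k) - XiP (z s) (star (z s)) k := rfl
      rw [h2, h1, ← hys]
      simp [a, b]
      ring
    have h3 := hs hmem j
    rw [fderiv_rho_eq] at h3
    have h4 : conjFun V (b s) = star (V (a s)) := by rw [hbs, conjFun, star_star]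
    have h5 : (a s).1 = z s := rfl
    simp only [G, h4, hys]
    rw [h5] at h3
    simpa using h3
  -- `Ψ` solves `z = q.1`, `y = q.2.1` and `w = q.2.2` for the parameters, so that `G ∘ Ψ` is the
  -- identity in the independent variables.
  let Ψ : ℂ × ℂ × (Fin 8 → ℂ) → ℂ × ℂ × (Fin 8 → ℂ) := fun q =>
    ((q.1 + q.2.1) / 2, (q.1 - q.2.1) / (2 * I), q.2.2 - (1 / 2 : ℂ) • XiP q.1 q.2.1)
  have hΨ : Tendsto Ψ (𝓝 0) (𝓝 0) := by
    have h1 : ContinuousAt (fun q : ℂ × ℂ × (Fin 8 → ℂ) => XiP q.1 q.2.1) 0 :=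
      (analyticAt_vec_XiP analyticAt_fst (analyticAt_fst.comp analyticAt_snd)).continuousAt
    have h2 : ContinuousAt Ψ 0 := by fun_prop
    have h3 : Ψ 0 = 0 := by simp [Ψ, XiP_zero_left]
    simpa [h3] using h2.tendsto
  filter_upwards [hΨ.eventually hG0] with q hq
  have hI : I ≠ 0 := I_ne_zero
  have e1 : z (Ψ q) = q.1 := by simp only [z, Ψ]; field_simp; ring
  have e2 : y (Ψ q) = q.2.1 := by simp only [y, Ψ]; field_simp; ring
  have e3 : a (Ψ q) = (q.1, q.2.2) := by
    simp only [a, e1, e2]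
    simp [Ψ]
  have e4 : b (Ψ q) = (q.2.1, q.2.2 - XiP q.1 q.2.1) := by
    simp only [b, e1, e2]
    refine Prod.ext rfl ?_
    simp only [Ψ]
    module
  simp only [G, e1, e2, e3, e4] at hq
  linear_combination hq

/-! ### Expansion of the tangency equation in the conjugate variable -/

/-- The coefficient of `y` in `XiP z y`. -/
noncomputable def xi1 (z : ℂ) : Fin 8 → ℂ :=
  ![2 * I * z, 2 * I * z ^ 2, 2 * z ^ 2, 2 * I * z ^ 3, 2 * z ^ 3, 0, 0, 0]

/-- The coefficient of `y ^ 2` in `XiP z y`. -/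
noncomputable def xi2 (z : ℂ) : Fin 8 → ℂ :=
  ![0, 2 * I * z, -(2 * z), 0, 0, 2 * I * z ^ 2, 2 * I * z ^ 3, 2 * z ^ 3]

/-- The coefficient of `y` in `XiZ z y`. -/
noncomputable def xiZ1 (z : ℂ) : Fin 8 → ℂ :=
  ![2 * I, 4 * I * z, 4 * z, 6 * I * z ^ 2, 6 * z ^ 2, 0, 0, 0]

/-- The coefficient of `y ^ 2` in `XiZ z y`. -/
noncomputable def xiZ2 (z : ℂ) : Fin 8 → ℂ :=
  ![0, 2 * I, -2, 0, 0, 4 * I * z, 6 * I * z ^ 2, 6 * z ^ 2]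

/-- The coefficient of `y` in `XiY z y`. -/
noncomputable def xiY1 (z : ℂ) : Fin 8 → ℂ :=
  ![0, 4 * I * z, -(4 * z), 0, 0, 4 * I * z ^ 2, 4 * I * z ^ 3, 4 * z ^ 3]

/-- The coefficient of `y ^ 2` in `XiY z y`. -/
noncomputable def xiY2 (z : ℂ) : Fin 8 → ℂ :=
  ![0, 0, 0, 6 * I * z, -(6 * z), 0, 6 * I * z ^ 2, -(6 * z ^ 2)]

theorem hasJet_XiP (z : ℂ) (j : Fin 8) : HasJet (fun y => XiP z y j) 0 (xi1 z j) (xi2 z j) := by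
  refine ⟨fun y => xi2 z j + y * (![0, 0, 0, 2 * I * z, -(2 * z), 0, 2 * I * z ^ 2,
    -(2 * z ^ 2)] : Fin 8 → ℂ) j, by fun_prop, by simp, .of_forall fun y => ?_⟩
  fin_cases j <;> simp [XiP, xi1, xi2] <;> ring

theorem hasJet_XiZ (z : ℂ) (j : Fin 8) : HasJet (fun y => XiZ z y j) 0 (xiZ1 z j) (xiZ2 z j) := by
  refine ⟨fun y => xiZ2 z j + y * (![0, 0, 0, 2 * I, -2, 0, 4 * I * z,
    -(4 * z)] : Fin 8 → ℂ) j, by fun_prop, by simp, .of_forall fun y => ?_⟩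
  fin_cases j <;> simp [XiZ, xiZ1, xiZ2] <;> ring

theorem hasJet_XiY (z : ℂ) (j : Fin 8) :
    HasJet (fun y => XiY z y j) (xi1 z j) (xiY1 z j) (xiY2 z j) := by
  refine ⟨fun _ => xiY2 z j, by fun_prop, by simp, .of_forall fun y => ?_⟩
  fin_cases j <;> simp [XiY, xi1, xiY1, xiY2] <;> ring

theorem XiZ_zero_right (z : ℂ) : XiZ z 0 = 0 := by
  funext j
  fin_cases j <;> simp [XiZ]

theorem XiY_zero_right (z : ℂ) : XiY z 0 = xi1 z := by
  funext j
  fin_cases j <;> simp [XiY, xi1]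

theorem xi1_zero : xi1 0 = 0 := by
  funext j
  fin_cases j <;> simp [xi1]

theorem star_xi1 (y : ℂ) (j : Fin 8) : star (xi1 (star y) j) = - XiZ 0 y j := by
  fin_cases j <;> simp [XiZ, xi1]

/-- The `W`-coefficients of a vector field along `z = 0`. -/
def restrW (V : Amb → Amb) (j : Fin 8) (w : Fin 8 → ℂ) : ℂ := (V (0, w)).2 j

/-- The `Z`-coefficient of a vector field along `z = 0`. -/
def restrZ (V : Amb → Amb) (w : Fin 8 → ℂ) : ℂ := (V (0, w)).1

theorem conjFun_restrZ (V : Amb → Amb) (w : Fin 8 → ℂ) :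
    conjFun (restrZ V) w = (conjFun V (0, w)).1 := by
  simp [-RCLike.star_def, conjFun, restrZ, show star ((0 : ℂ), w) = (0, star w) from Prod.ext (star_zero ℂ) rfl]

theorem conjFun_restrW (V : Amb → Amb) (j : Fin 8) (w : Fin 8 → ℂ) :
    conjFun (restrW V j) w = (conjFun V (0, w)).2 j := by
  simp [-RCLike.star_def, conjFun, restrW, show star ((0 : ℂ), w) = (0, star w) from Prod.ext (star_zero ℂ) rfl]

section
variable {V : Amb → Amb}

theorem analyticAt_incl : AnalyticAt ℂ (fun w : Fin 8 → ℂ => ((0, w) : Amb)) 0 :=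
  analyticAt_const.prod analyticAt_id

theorem analyticAt_restrW (hV : AnalyticAt ℂ V 0) (j : Fin 8) : AnalyticAt ℂ (restrW V j) 0 :=
  analyticAt_pi_iff.1 (analyticAt_snd.comp (AnalyticAt.fun_comp (x := (0 : Fin 8 → ℂ))
    (g := V) (f := fun w => (0, w)) hV analyticAt_incl)) j

theorem analyticAt_restrZ (hV : AnalyticAt ℂ V 0) : AnalyticAt ℂ (restrZ V) 0 :=
  analyticAt_fst.comp (AnalyticAt.fun_comp (x := (0 : Fin 8 → ℂ))
    (g := V) (f := fun w => (0, w)) hV analyticAt_incl)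

/-- At `y = 0` both `Ξ` and `Ξ_z` vanish and `Ξ_y` becomes `xi1`. The `z`-dependence of every `W^j`
is thereby determined by the data on `z = 0`. -/
theorem eventually_V_eq (hV : AnalyticAt ℂ V 0) (tV : IsTangent V) :
    ∀ᶠ q : Amb in 𝓝 0, ∀ j,
      (V q).2 j = conjFun (restrW V j) q.2 + xi1 q.1 j * conjFun (restrZ V) q.2 := by
  have h1 : Tendsto (fun q : Amb => (q.1, (0 : ℂ), q.2)) (𝓝 0) (𝓝 0) := by
    have : Continuous fun q : Amb => (q.1, (0 : ℂ), q.2) := by fun_prop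
    exact this.tendsto 0
  filter_upwards [h1.eventually (tangency_complexified hV tV)] with q hq j
  have := hq j
  simp only [XiP_zero_right, XiZ_zero_right, XiY_zero_right, sub_zero, Pi.zero_apply, zero_mul,
    zero_add] at this
  rw [conjFun_restrW, conjFun_restrZ]
  linear_combination this

/-- The case `z = 0` of `eventually_V_eq`. This reality of `A_j` is what later splits one complex
equation into two. -/
theorem conjFun_restrW_eq (hV : AnalyticAt ℂ V 0) (tV : IsTangent V) (j : Fin 8) :
    conjFun (restrW V j) =ᶠ[𝓝 0] restrW V j := by
  have h1 : Tendsto (fun w : Fin 8 → ℂ => ((0, w) : Amb)) (𝓝 0) (𝓝 0) :=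
    analyticAt_incl.continuousAt.tendsto
  filter_upwards [h1.eventually (eventually_V_eq hV tV)] with w hw
  have := hw j
  simp only [xi1_zero, Pi.zero_apply, zero_mul, add_zero] at this
  exact this.symm

theorem eventually_V_eq' (hV : AnalyticAt ℂ V 0) (tV : IsTangent V) :
    ∀ᶠ q : Amb in 𝓝 0, ∀ j,
      (V q).2 j = restrW V j q.2 + xi1 q.1 j * conjFun (restrZ V) q.2 := by
  have h1 : Tendsto (fun q : Amb => q.2) (𝓝 0) (𝓝 0) := continuous_snd.tendsto (0 : Amb)
  filter_upwards [eventually_V_eq hV tV,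
    h1.eventually (eventually_all.2 (conjFun_restrW_eq hV tV))] with q h2 h3 j
  rw [h2, h3]

theorem eventually_conj_V_eq (hV : AnalyticAt ℂ V 0) (tV : IsTangent V) :
    ∀ᶠ q : Amb in 𝓝 0, ∀ j,
      (conjFun V q).2 j = restrW V j q.2 - XiZ 0 q.1 j * restrZ V q.2 := by
  have h1 : Tendsto (fun q : Amb => q.2) (𝓝 0) (𝓝 0) := continuous_snd.tendsto (0 : Amb)
  filter_upwards [eventually_star (eventually_V_eq' hV tV),
    h1.eventually (eventually_all.2 (conjFun_restrW_eq hV tV))] with q h2 h3 j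
  have h4 := congrArg star (h2 j)
  have h5 : star (restrW V j (star q).2) = restrW V j q.2 := h3 j
  rw [star_add, star_mul', h5, Prod.fst_star, star_xi1] at h4
  have h6 : star (conjFun (restrZ V) (star q).2) = restrZ V q.2 := by
    simp [conjFun, Prod.snd_star]
  rw [h6] at h4
  have h7 : (conjFun V q).2 j = star ((V (star q)).2 j) := rfl
  linear_combination h4 + h7

/-- The tangency equation, with the `W`-coefficients expressed through their restrictions to
`z = 0`. -/
theorem tangency_restricted (hV : AnalyticAt ℂ V 0) (tV : IsTangent V) :
    ∀ᶠ w : Fin 8 → ℂ in 𝓝 0, ∀ᶠ z : ℂ in 𝓝 0, ∀ᶠ y : ℂ in 𝓝 0, ∀ j,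
      restrW V j w + xi1 z j * conjFun (restrZ V) w
        - restrW V j (w - XiP z y) + XiZ 0 y j * restrZ V (w - XiP z y)
        = XiZ z y j * (V (z, w)).1 + XiY z y j * (conjFun V (y, w - XiP z y)).1 := by
  have h : ∀ᶠ q : (Fin 8 → ℂ) × ℂ × ℂ in 𝓝 0, ∀ j,
      restrW V j q.1 + xi1 q.2.1 j * conjFun (restrZ V) q.1
        - restrW V j (q.1 - XiP q.2.1 q.2.2) + XiZ 0 q.2.2 j * restrZ V (q.1 - XiP q.2.1 q.2.2)
        = XiZ q.2.1 q.2.2 j * (V (q.2.1, q.1)).1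
          + XiY q.2.1 q.2.2 j * (conjFun V (q.2.2, q.1 - XiP q.2.1 q.2.2)).1 := by
    have hX : ContinuousAt (fun q : (Fin 8 → ℂ) × ℂ × ℂ => XiP q.2.1 q.2.2) 0 :=
      (analyticAt_vec_XiP (analyticAt_fst.comp analyticAt_snd)
        (analyticAt_snd.comp analyticAt_snd)).continuousAt
    have h1 : Tendsto (fun q : (Fin 8 → ℂ) × ℂ × ℂ => (q.2.1, q.2.2, q.1)) (𝓝 0) (𝓝 0) := by
      have : Continuous fun q : (Fin 8 → ℂ) × ℂ × ℂ => (q.2.1, q.2.2, q.1) := by fun_prop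
      exact this.tendsto 0
    have h2 : Tendsto (fun q : (Fin 8 → ℂ) × ℂ × ℂ => ((q.2.1, q.1) : Amb)) (𝓝 0) (𝓝 0) := by
      have : Continuous fun q : (Fin 8 → ℂ) × ℂ × ℂ => ((q.2.1, q.1) : Amb) := by fun_prop
      exact this.tendsto 0
    have h3 : Tendsto (fun q : (Fin 8 → ℂ) × ℂ × ℂ => ((q.2.2, q.1 - XiP q.2.1 q.2.2) : Amb))
        (𝓝 0) (𝓝 0) := by
      have : ContinuousAt (fun q : (Fin 8 → ℂ) × ℂ × ℂ =>
        ((q.2.2, q.1 - XiP q.2.1 q.2.2) : Amb)) 0 := by fun_prop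
      have h0 : ((0, 0 - XiP 0 0) : Amb) = 0 := by simp [XiP_zero_left]
      have h4 : Tendsto _ _ (𝓝 ((0, 0 - XiP 0 0) : Amb)) := this
      rwa [h0] at h4
    filter_upwards [h1.eventually (tangency_complexified hV tV),
      h2.eventually (eventually_V_eq' hV tV), h3.eventually (eventually_conj_V_eq hV tV)]
      with q e1 e2 e3 j
    linear_combination e1 j - e2 j + e3 j
  -- The nested form fixes `w`, then `z`, so that the jets at `y = 0` can be taken one point `(z,
  -- w)` at a time.
  exact h.curry_nhds.mono fun w hw => hw.curry_nhds

/-- The terms of first and second order in `y` of the tangency equation. -/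
theorem jet_equations {A P Q : (Fin 8 → ℂ) → ℂ} {Y : ℂ → ℂ} {w : Fin 8 → ℂ} {z Z D D2 : ℂ}
    {j : Fin 8} (hA : AnalyticAt ℂ A w) (hP : AnalyticAt ℂ P w) (hY : HasJet Y (Q w) D D2)
    (h : ∀ᶠ y in 𝓝 0, A w + xi1 z j * Q w - A (w - XiP z y) + XiZ 0 y j * P (w - XiP z y)
      = XiZ z y j * Z + XiY z y j * Y y) :
    (∑ k, xi1 z k * pd k A w + xiZ1 0 j * P w = xiZ1 z j * Z + xi1 z j * D + xiY1 z j * Q w) ∧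
    (∑ k, xi2 z k * pd k A w - (∑ k, xi1 z k * ∑ l, xi1 z l * pd l (pd k A) w) / 2
      + xiZ2 0 j * P w - xiZ1 0 j * ∑ k, xi1 z k * pd k P w
      = xiZ2 z j * Z + xi1 z j * D2 + xiY1 z j * D + xiY2 z j * Q w) := by
  have hX : ∀ k, AnalyticAt ℂ (fun s => XiP z s k) 0 := fun k =>
    analyticAt_XiP analyticAt_const analyticAt_id k
  have jA := HasJet.comp_sub hA hX (hasJet_XiP z)
  have jP := HasJet.comp_sub hP hX (hasJet_XiP z)
  have jL := ((HasJet.const (A w + xi1 z j * Q w)).sub jA).add ((hasJet_XiZ 0 j).mul jP)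
  have jR := ((hasJet_XiZ z j).mul (HasJet.const Z)).add ((hasJet_XiY z j).mul hY)
  obtain ⟨-, h1, h2⟩ := jL.unique jR h
  refine ⟨by linear_combination h1, by linear_combination h2⟩

end

/-! ### Calculus of partial derivatives near the origin -/

theorem conjFun_involutive {E F : Type*} [NormedAddCommGroup E] [StarAddMonoid E]
    [NormedAddCommGroup F] [StarAddMonoid F] (f : E → F) : conjFun (conjFun f) = f := by
  funext x
  simp [conjFun]

/-- The partial derivative in the `i`-th direction vanishes near the origin. -/
def Flat (i : Fin 8) (g : (Fin 8 → ℂ) → ℂ) : Prop := ∀ᶠ w in 𝓝 0, pd i g w = 0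

theorem Flat.conj {i : Fin 8} {g : (Fin 8 → ℂ) → ℂ} (hg : AnalyticAt ℂ g 0) (h : Flat i g) :
    Flat i (conjFun g) := by
  filter_upwards [eventually_star h, eventually_star hg.eventually_analyticAt] with w h1 h2
  rw [pd_conjFun i w h2, h1, star_zero]

/-- Conjugation commutes with `pd` and fixes `A`, so only the coefficient `2 i` changes sign.
Together with the original equation this determines both derivatives. -/
theorem pd_conj_pair {A r : (Fin 8 → ℂ) → ℂ} {k l : Fin 8} (hA : AnalyticAt ℂ A 0)
    (hr : conjFun A =ᶠ[𝓝 0] A) (h : ∀ᶠ w in 𝓝 0, 2 * I * pd k A w + 2 * pd l A w = r w) :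
    ∀ᶠ w in 𝓝 0, -(2 * I) * pd k A w + 2 * pd l A w = conjFun r w := by
  filter_upwards [eventually_star h, eventually_star hA.eventually_analyticAt, pd_congr hr k,
    pd_congr hr l] with w h1 h2 h3 h4
  rw [pd_conjFun _ _ h2] at h3 h4
  have h5 := congrArg star h1
  have h6 : star (2 : ℂ) = 2 := Complex.conj_ofNat 2
  have h7 : star I = -I := Complex.conj_I
  rw [star_add, star_mul', star_mul', star_mul', h3, h4, h6, h7] at h5
  rw [conjFun]
  linear_combination h5

theorem pd_pair {A r : (Fin 8 → ℂ) → ℂ} {k l : Fin 8} (hA : AnalyticAt ℂ A 0)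
    (hr : conjFun A =ᶠ[𝓝 0] A) (h : ∀ᶠ w in 𝓝 0, 2 * I * pd k A w + 2 * pd l A w = r w) :
    ∀ᶠ w in 𝓝 0, pd k A w = -(I / 4) * (r w - conjFun r w) ∧
      pd l A w = (1 / 4) * (r w + conjFun r w) := by
  filter_upwards [h, pd_conj_pair hA hr h] with w h1 h2
  exact ⟨by linear_combination (-(I / 4)) * h1 + (I / 4) * h2 + pd k A w * I_sq,
    by linear_combination (1 / 4) * h1 + (1 / 4) * h2⟩

theorem pd_pair_zero {A : (Fin 8 → ℂ) → ℂ} {k l : Fin 8} (hA : AnalyticAt ℂ A 0)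
    (hr : conjFun A =ᶠ[𝓝 0] A) (h : ∀ᶠ w in 𝓝 0, 2 * I * pd k A w + 2 * pd l A w = 0) :
    ∀ᶠ w in 𝓝 0, pd k A w = 0 ∧ pd l A w = 0 := by
  filter_upwards [pd_pair (r := fun _ => 0) hA hr h] with w hw
  simpa [conjFun] using hw

theorem pd_add_mul {f g : (Fin 8 → ℂ) → ℂ} {w : Fin 8 → ℂ} (hf : AnalyticAt ℂ f w)
    (hg : AnalyticAt ℂ g w) (α β : ℂ) (i : Fin 8) :
    pd i (fun w => α * f w + β * g w) w = α * pd i f w + β * pd i g w := by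
  have := (hf.differentiableAt.hasFDerivAt.const_mul α).add
    (hg.differentiableAt.hasFDerivAt.const_mul β)
  have h2 : HasFDerivAt (fun w => α * f w + β * g w) _ w := this
  simp [pd, h2.fderiv]

theorem Flat.add_mul {f g : (Fin 8 → ℂ) → ℂ} (hf : AnalyticAt ℂ f 0)
    (hg : AnalyticAt ℂ g 0) (α β : ℂ) {i : Fin 8} (h1 : Flat i f) (h2 : Flat i g) :
    Flat i (fun w => α * f w + β * g w) := by
  filter_upwards [hf.eventually_analyticAt, hg.eventually_analyticAt, h1, h2] with w e1 e2 e3 e4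
  rw [pd_add_mul e1 e2, e3, e4, mul_zero, mul_zero, add_zero]

theorem flat_zero (i : Fin 8) : Flat i (fun _ => 0) := .of_forall fun w => by simp [pd]

theorem Flat.congr {f g : (Fin 8 → ℂ) → ℂ} {i : Fin 8} (hf : Flat i f) (h : f =ᶠ[𝓝 0] g) :
    Flat i g := by
  filter_upwards [hf, pd_congr h i] with w h1 h2
  rw [← h2, h1]

/-- If `g` is a combination of `∂_k A` and `∂_l A`, then `∂_i g = 0` as soon as `∂_k` and `∂_l`
annihilate `∂_i A`. -/
theorem flat_of_comb {A g h : (Fin 8 → ℂ) → ℂ} {i k l : Fin 8} {α β : ℂ}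
    (hA : AnalyticAt ℂ A 0) (hg : ∀ᶠ w in 𝓝 0, g w = α * pd k A w + β * pd l A w)
    (hi : ∀ᶠ w in 𝓝 0, pd i A w = h w) (hk : Flat k h) (hl : Flat l h) : Flat i g := by
  have f1 : ∀ {m : Fin 8}, Flat m h → Flat i (pd m A) := by
    intro m hm
    filter_upwards [hA.eventually_analyticAt, hm, pd_congr hi m] with w e1 e2 e3
    rw [pd_comm e1, e3, e2]
  refine (Flat.add_mul (analyticAt_pd hA k) (analyticAt_pd hA l) α β (f1 hk) (f1 hl)).congr ?_
  filter_upwards [hg] with w hw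
  exact hw.symm

/-- After subtraction of the linear form with coefficients `c`, the differential vanishes on a ball,
which is connected. -/
theorem eq_affine_of_pd {g : (Fin 8 → ℂ) → ℂ} (hg : AnalyticAt ℂ g 0) {c : Fin 8 → ℂ}
    (h : ∀ k, ∀ᶠ w in 𝓝 0, pd k g w = c k) : ∀ᶠ w in 𝓝 0, g w = g 0 + ∑ k, w k * c k := by
  obtain ⟨R, hR, hball⟩ :=
    Metric.eventually_nhds_iff_ball.1 (hg.eventually_analyticAt.and (eventually_all.2 h))
  let L : (Fin 8 → ℂ) →L[ℂ] ℂ :=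
    ∑ k, c k • ContinuousLinearMap.proj (R := ℂ) (φ := fun _ : Fin 8 => ℂ) k
  have hL : ∀ w : Fin 8 → ℂ, L w = ∑ k, w k * c k := fun w => by simp [L, mul_comm]
  have hd : ∀ w ∈ Metric.ball (0 : Fin 8 → ℂ) R, HasFDerivAt (fun w => g w - L w) (0 : (Fin 8 → ℂ) →L[ℂ] ℂ) w := by
    intro w hw
    have h1 := ((hball w hw).1.differentiableAt.hasFDerivAt).sub L.hasFDerivAt
    have h2 : fderiv ℂ g w - L = 0 := by
      ext v
      rw [sub_apply, fderiv_eq_sum_pd, hL]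
      simp [(hball w hw).2]
    rw [h2] at h1
    exact h1
  refine Metric.eventually_nhds_iff_ball.2 ⟨R, hR, fun w hw => ?_⟩
  have h3 := (convex_ball (0 : Fin 8 → ℂ) R).isPreconnected
  have h4 := Metric.isOpen_ball.is_const_of_fderiv_eq_zero h3
    (fun w hw => (hd w hw).differentiableAt.differentiableWithinAt)
    (fun w hw => (hd w hw).fderiv) hw (Metric.mem_ball_self hR)
  simp only [hL, Pi.zero_apply, zero_mul, Finset.sum_const_zero, sub_zero] at h4
  linear_combination h4

theorem Flat.eq_const {g : (Fin 8 → ℂ) → ℂ} (hg : AnalyticAt ℂ g 0) (h : ∀ k, Flat k g) :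
    ∀ᶠ w in 𝓝 0, g w = g 0 := by
  filter_upwards [eq_affine_of_pd hg (c := 0) h] with w hw
  simpa using hw

/-- A function that is analytic at the origin and vanishes near `0` on almost all slices vanishes
near the origin. -/
theorem eventually_zero_of_slices {g : Amb → ℂ} (hg : AnalyticAt ℂ g 0)
    (h : ∀ᶠ w : Fin 8 → ℂ in 𝓝 0, ∀ᶠ z : ℂ in 𝓝 0, g (z, w) = 0) : ∀ᶠ q in 𝓝 0, g q = 0 := by
  obtain ⟨R, hR, hball⟩ := Metric.eventually_nhds_iff_ball.1 hg.eventually_analyticAt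
  have h2 : Tendsto (fun q : Amb => q.2) (𝓝 0) (𝓝 0) := continuous_snd.tendsto (0 : Amb)
  filter_upwards [h2.eventually h, Metric.ball_mem_nhds (0 : Amb) hR] with q hq hqR
  have hq1 : ‖q.1‖ < R := (norm_fst_le q).trans_lt (by simpa using hqR)
  have hq2 : ‖q.2‖ < R := (norm_snd_le q).trans_lt (by simpa using hqR)
  -- The neighbourhood in `z` on which a slice vanishes may shrink with `w`. Analyticity on a disc
  -- of fixed radius `R` removes this dependence.
  have han : AnalyticOnNhd ℂ (fun z : ℂ => g (z, q.2)) (Metric.ball 0 R) := by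
    intro z hz
    have h3 : AnalyticAt ℂ (fun z : ℂ => ((z, q.2) : Amb)) z := analyticAt_id.prod analyticAt_const
    refine AnalyticAt.fun_comp (hball _ ?_) h3
    rw [mem_ball_zero_iff] at hz ⊢
    exact max_lt hz hq2
  exact han.eqOn_zero_of_preconnected_of_eventuallyEq_zero
    (convex_ball (0 : ℂ) R).isPreconnected (Metric.mem_ball_self hR) hq
    (show q.1 ∈ Metric.ball 0 R by simpa using hq1)

/-- `xi1` has entries of degree one, two and three in `z`, the last two degrees each shared by a
pair of coordinates. Hence the derivatives in `(w^2, w^3)` and in `(w^4, w^5)` always appear as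
pairs. -/
theorem coeffs_xi1 {a : Fin 8 → ℂ} {r0 r1 r2 r3 r4 : ℂ}
    (h : ∀ᶠ z in 𝓝 0, ∑ k, xi1 z k * a k = r0 + r1 * z + r2 * z ^ 2 + r3 * z ^ 3 + r4 * z ^ 4) :
    2 * I * a 0 = r1 ∧ 2 * I * a 1 + 2 * a 2 = r2 ∧ 2 * I * a 3 + 2 * a 4 = r3 := by
  obtain ⟨-, h1, h2, h3, -⟩ := eq_zero_of_poly_eq_zero (c0 := -r0) (c1 := 2 * I * a 0 - r1)
    (c2 := 2 * I * a 1 + 2 * a 2 - r2) (c3 := 2 * I * a 3 + 2 * a 4 - r3) (c4 := -r4) (c5 := 0)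
    (c6 := 0) (h.mono fun z hz => by
      simp [Fin.sum_univ_eight, xi1] at hz
      linear_combination hz)
  exact ⟨sub_eq_zero.1 h1, sub_eq_zero.1 h2, sub_eq_zero.1 h3⟩

/-- Only the powers that involve `w^6, w^7, w^8` are kept; the coefficient of `z` concerns `w^2,
w^3`, whose derivatives come from order one. The slots up to `r6` allow for higher powers on the
right-hand side. -/
theorem coeffs_xi2 {a : Fin 8 → ℂ} {r0 r1 r2 r3 r4 r5 r6 : ℂ}
    (h : ∀ᶠ z in 𝓝 0, ∑ k, xi2 z k * a k = r0 + r1 * z + r2 * z ^ 2 + r3 * z ^ 3 + r4 * z ^ 4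
      + r5 * z ^ 5 + r6 * z ^ 6) :
    2 * I * a 5 = r2 ∧ 2 * I * a 6 + 2 * a 7 = r3 := by
  obtain ⟨-, -, h2, h3, -⟩ := eq_zero_of_poly_eq_zero (c0 := -r0)
    (c1 := 2 * I * a 1 - 2 * a 2 - r1)
    (c2 := 2 * I * a 5 - r2) (c3 := 2 * I * a 6 + 2 * a 7 - r3) (c4 := -r4) (c5 := -r5)
    (c6 := -r6) (h.mono fun z hz => by
      simp [Fin.sum_univ_eight, xi2] at hz
      linear_combination hz)
  exact ⟨sub_eq_zero.1 h2, sub_eq_zero.1 h3⟩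

/-! ### The restriction of the `Z`-coefficient to `z = 0` -/

section
variable {V : Amb → Amb}

theorem eventually_slice {P : Amb → Prop} (h : ∀ᶠ q in 𝓝 0, P q) :
    ∀ᶠ w : Fin 8 → ℂ in 𝓝 0, P (0, w) :=
  analyticAt_incl.continuousAt.tendsto.eventually h

theorem analyticAt_conjFun_slice (hV : AnalyticAt ℂ V 0) :
    ∀ᶠ w : Fin 8 → ℂ in 𝓝 0, AnalyticAt ℂ (fun q => (conjFun V q).1) (0, w) := by
  have h : AnalyticAt ℂ (fun q => (conjFun V q).1) (0 : Amb) :=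
    analyticAt_fst.comp (analyticAt_conjFun (by rwa [star_zero]))
  exact eventually_slice h.eventually_analyticAt

/-- The terms of first order in the conjugate variable. -/
theorem first_order (hV : AnalyticAt ℂ V 0) (tV : IsTangent V) :
    ∀ᶠ w : Fin 8 → ℂ in 𝓝 0, ∀ᶠ z : ℂ in 𝓝 0, ∀ j,
      ∑ k, xi1 z k * pd k (restrW V j) w + xiZ1 0 j * restrZ V w
        = xiZ1 z j * (V (z, w)).1
          + xi1 z j * (fderiv ℂ (fun q => (conjFun V q).1) (0, w) (1, 0)
            - ∑ k, xi1 z k * pd k (conjFun (restrZ V)) w)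
          + xiY1 z j * conjFun (restrZ V) w := by
  filter_upwards [tangency_restricted hV tV,
    eventually_all.2 fun j => (analyticAt_restrW hV j).eventually_analyticAt,
    (analyticAt_restrZ hV).eventually_analyticAt, analyticAt_conjFun_slice hV] with w h hA hP hY
  filter_upwards [h] with z hz j
  let U : Amb → ℂ := fun q => (conjFun V q).1
  have hc : AnalyticAt ℂ (fun y : ℂ => ((y, w - XiP z y) : Amb)) 0 :=
    analyticAt_id.prod (analyticAt_const.sub (analyticAt_vec_XiP analyticAt_const analyticAt_id))
  have hUc : AnalyticAt ℂ (fun y : ℂ => U (y, w - XiP z y)) 0 :=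
    AnalyticAt.fun_comp (by simpa [XiP_zero_right] using hY) hc
  have hJ := HasJet.of_analyticAt hUc
  have e0 : U (0, w - XiP z 0) = conjFun (restrZ V) w := by
    rw [XiP_zero_right, sub_zero, conjFun_restrZ]
  have hXd : ∀ k, HasDerivAt (fun y => XiP z y k) (xi1 z k) 0 := fun k => by
    have h1 : AnalyticAt ℂ (fun y => XiP z y k) 0 := analyticAt_XiP analyticAt_const analyticAt_id k
    have h2 := (HasJet.of_analyticAt h1).unique (hasJet_XiP z k) (.of_forall fun _ => rfl)
    rw [← h2.2.1]
    exact h1.differentiableAt.hasDerivAt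
  have hcd : HasDerivAt (fun y : ℂ => ((y, w - XiP z y) : Amb)) (1, -xi1 z) 0 :=
    (hasDerivAt_id 0).prodMk ((hasDerivAt_pi.2 hXd).const_sub w)
  have hU' : HasFDerivAt U (fderiv ℂ U (0, w)) (0, w - XiP z 0) := by
    simpa [XiP_zero_right] using hY.differentiableAt.hasFDerivAt
  -- The curve `y ↦ (y, w - Ξ(z, y))` has velocity `(1, -xi1 z)` at `0`. Its second component
  -- differentiates the restriction of `U` to `z = 0`.
  have e1 : deriv (fun y : ℂ => U (y, w - XiP z y)) 0
      = fderiv ℂ U (0, w) (1, 0) - ∑ k, xi1 z k * pd k (conjFun (restrZ V)) w := by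
    have h1 : HasDerivAt (fun y : ℂ => U (y, w - XiP z y)) (fderiv ℂ U (0, w) (1, -xi1 z)) 0 :=
      hU'.comp_hasDerivAt (f := fun y : ℂ => ((y, w - XiP z y) : Amb)) (0 : ℂ) hcd
    rw [h1.deriv, show ((1, -xi1 z) : Amb) = (1, 0) - (0, xi1 z) by simp, map_sub,
      ← fderiv_eq_sum_pd]
    have h2 : HasFDerivAt (fun w : Fin 8 → ℂ => U (0, w))
        ((fderiv ℂ U (0, w)).comp (ContinuousLinearMap.inr ℂ ℂ (Fin 8 → ℂ))) w :=
      (hY.differentiableAt.hasFDerivAt).comp w (hasFDerivAt_prodMk_right (0 : ℂ) w)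
    have h3 : conjFun (restrZ V) = fun w : Fin 8 → ℂ => U (0, w) := funext (conjFun_restrZ V)
    rw [h3, h2.fderiv]
    simp
  rw [e0, e1] at hJ
  exact (jet_equations (hA j) hP hJ (hz.mono fun y hy => hy j)).1

/-- For `W^6` and `W^7` the entries of `xi1` and `xiZ1` vanish, so only `xiY1 · P̄` remains on the
right. Thus `∂_1, ∂_4, ∂_5` annihilate `A_6`, while `P̄` is a combination of `∂_2 A_6, ∂_3 A_6`.
Likewise `∂_2, ∂_3` annihilate `A_7`, while `P̄` is a combination of `∂_4 A_7, ∂_5 A_7`. Commuting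
derivatives covers all five directions. -/
theorem flat_conjFun_restrZ (hV : AnalyticAt ℂ V 0) (tV : IsTangent V) (k : Fin 8) (hk : k < 5) :
    Flat k (conjFun (restrZ V)) := by
  have h5 : ∀ᶠ w in 𝓝 0, 2 * I * pd 0 (restrW V 5) w = 0 ∧
      2 * I * pd 1 (restrW V 5) w + 2 * pd 2 (restrW V 5) w = 4 * I * conjFun (restrZ V) w ∧
      2 * I * pd 3 (restrW V 5) w + 2 * pd 4 (restrW V 5) w = 0 :=
    (first_order hV tV).mono fun w hw => coeffs_xi1 (a := fun k => pd k (restrW V 5) w)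
      (r0 := 0) (r4 := 0) (hw.mono fun z hz => by
        have := hz 5
        simp only [xiZ1, xi1, xiY1] at this ⊢
        simp at this ⊢
        linear_combination this)
  have h6 : ∀ᶠ w in 𝓝 0, 2 * I * pd 0 (restrW V 6) w = 0 ∧
      2 * I * pd 1 (restrW V 6) w + 2 * pd 2 (restrW V 6) w = 0 ∧
      2 * I * pd 3 (restrW V 6) w + 2 * pd 4 (restrW V 6) w = 4 * I * conjFun (restrZ V) w :=
    (first_order hV tV).mono fun w hw => coeffs_xi1 (a := fun k => pd k (restrW V 6) w)
      (r0 := 0) (r4 := 0) (hw.mono fun z hz => by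
        have := hz 6
        simp only [xiZ1, xi1, xiY1] at this ⊢
        simp at this ⊢
        linear_combination this)
  have hA := analyticAt_restrW hV
  have hr := conjFun_restrW_eq hV tV
  have h5' := pd_pair_zero (hA 5) (hr 5) (h5.mono fun w hw => hw.2.2)
  have h6' := pd_pair_zero (hA 6) (hr 6) (h6.mono fun w hw => hw.2.1)
  have hI : I ≠ 0 := I_ne_zero
  have g5 : ∀ᶠ w in 𝓝 0, conjFun (restrZ V) w
      = (1 / 2) * pd 1 (restrW V 5) w + (1 / (2 * I)) * pd 2 (restrW V 5) w := by
    filter_upwards [h5] with w hw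
    field_simp
    linear_combination (-1 / 2) * hw.2.1
  have g6 : ∀ᶠ w in 𝓝 0, conjFun (restrZ V) w
      = (1 / 2) * pd 3 (restrW V 6) w + (1 / (2 * I)) * pd 4 (restrW V 6) w := by
    filter_upwards [h6] with w hw
    field_simp
    linear_combination (-1 / 2) * hw.2.2
  have fin : ∀ {i l m j : Fin 8} {α β : ℂ}, (∀ᶠ w in 𝓝 0, conjFun (restrZ V) w
      = α * pd l (restrW V j) w + β * pd m (restrW V j) w) →
      (∀ᶠ w in 𝓝 0, pd i (restrW V j) w = 0) → Flat i (conjFun (restrZ V)) :=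
    fun hg hi => flat_of_comb (hA _) hg hi (flat_zero _) (flat_zero _)
  obtain rfl | rfl | rfl | rfl | rfl : k = 0 ∨ k = 1 ∨ k = 2 ∨ k = 3 ∨ k = 4 := by
    revert k
    decide
  · refine fin g5 (h5.mono fun w hw => ?_)
    simpa using hw.1
  · exact fin g6 (h6'.mono fun w hw => hw.1)
  · exact fin g6 (h6'.mono fun w hw => hw.2)
  · exact fin g5 (h5'.mono fun w hw => hw.1)
  · exact fin g5 (h5'.mono fun w hw => hw.2)

theorem flat_restrZ (hV : AnalyticAt ℂ V 0) (tV : IsTangent V) (k : Fin 8) (hk : k < 5) :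
    Flat k (restrZ V) := by
  have h := (flat_conjFun_restrZ hV tV k hk).conj
    (analyticAt_conjFun (by rw [star_zero]; exact analyticAt_restrZ hV))
  rwa [conjFun_involutive] at h

/-- The `Z`-coefficient is affine in `z`. -/
theorem exists_affine_Z (hV : AnalyticAt ℂ V 0) (tV : IsTangent V) :
    ∃ M : (Fin 8 → ℂ) → ℂ, AnalyticAt ℂ M 0 ∧
      ∀ᶠ q : Amb in 𝓝 0, (V q).1 = restrZ V q.2 + q.1 * M q.2 := by
  let U : Amb → ℂ := fun q => (conjFun V q).1
  let N : (Fin 8 → ℂ) → ℂ := fun w => fderiv ℂ U (0, w) (1, 0)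
  have hU : AnalyticAt ℂ U 0 := analyticAt_fst.comp (analyticAt_conjFun (by rwa [star_zero]))
  have hN : AnalyticAt ℂ N 0 := by
    have h1 : AnalyticAt ℂ (fun w : Fin 8 → ℂ => fderiv ℂ U (0, w)) 0 :=
      AnalyticAt.fun_comp (x := (0 : Fin 8 → ℂ)) (g := fderiv ℂ U)
        (f := fun w => ((0, w) : Amb)) hU.fderiv analyticAt_incl
    exact ((ContinuousLinearMap.apply ℂ ℂ ((1, 0) : Amb)).analyticAt _).comp h1
  have hA := analyticAt_restrW hV 3
  -- The order-one equation for `W^4` has `6 i z² Z + 2 i z³ N` on the right and a cubic in `z` on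
  -- the left. Dividing by `z²` shows that `Z` is affine in `z`, with this slope.
  let M : (Fin 8 → ℂ) → ℂ := fun w =>
    (1 / (6 * I)) * (2 * I * pd 3 (restrW V 3) w + 2 * pd 4 (restrW V 3) w - 2 * I * N w)
  have hM : AnalyticAt ℂ M 0 := analyticAt_const.mul
    (((analyticAt_const.mul (analyticAt_pd hA 3)).add
      (analyticAt_const.mul (analyticAt_pd hA 4))).sub (analyticAt_const.mul hN))
  have hI : I ≠ 0 := I_ne_zero
  refine ⟨M, hM, ?_⟩
  have hV1 : AnalyticAt ℂ (fun q => (V q).1) 0 := analyticAt_fst.comp hV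
  have key : ∀ᶠ w : Fin 8 → ℂ in 𝓝 0, ∀ᶠ z : ℂ in 𝓝 0,
      (V (z, w)).1 = restrZ V w + z * M w := by
    filter_upwards [first_order hV tV, eventually_all.2 fun k : Fin 8 =>
      eventually_all.2 fun hk => flat_conjFun_restrZ hV tV k hk,
      eventually_slice hV1.eventually_analyticAt] with w h hflat hVw
    set a := fun k => pd k (restrW V 3) w with ha
    have hc : ContinuousAt (fun z : ℂ => (V (z, w)).1) 0 := by
      have : ContinuousAt (fun z : ℂ => ((z, w) : Amb)) 0 := by fun_prop
      exact ContinuousAt.comp (g := fun q => (V q).1) hVw.continuousAt this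
    -- Two factors of `z` are cancelled. The value at `0` of the remaining factor identifies the
    -- constant term of `Z` as `Z(0, w)`.
    have h1 : ∀ᶠ z in 𝓝 0, 0 + z * (2 * I * a 0 + z * (2 * I * a 1 + 2 * a 2
        + z * (2 * I * a 3 + 2 * a 4 - 2 * I * N w) - 6 * I * (V (z, w)).1)) = 0 := by
      filter_upwards [h] with z hz
      have h2 := hz 3
      have h3 : ∑ k, xi1 z k * pd k (conjFun (restrZ V)) w = 0 := by
        simp only [Fin.sum_univ_eight]
        rw [hflat 0 (by decide), hflat 1 (by decide), hflat 2 (by decide), hflat 3 (by decide),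
          hflat 4 (by decide)]
        simp [xi1]
      rw [h3] at h2
      simp [Fin.sum_univ_eight, xi1, xiZ1, xiY1] at h2
      simp only [ha, N, U]
      linear_combination h2
    obtain ⟨-, -, h2⟩ := eq_zero_of_add_mul_eq_zero (by fun_prop) h1
    obtain ⟨-, h3, h4⟩ := eq_zero_of_add_mul_eq_zero (by fun_prop) h2
    filter_upwards [h4] with z hz
    have h5 : restrZ V w = (V (0, w)).1 := rfl
    simp only [M, h5]
    simp only [ha] at hz h3
    field_simp
    linear_combination h3 - hz
  have hg : AnalyticAt ℂ (fun q : Amb => (V q).1 - (restrZ V q.2 + q.1 * M q.2)) 0 := by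
    have h1 : AnalyticAt ℂ (fun q : Amb => restrZ V q.2) 0 :=
      AnalyticAt.fun_comp (x := (0 : Amb)) (g := restrZ V) (f := fun q : Amb => q.2)
        (analyticAt_restrZ hV) analyticAt_snd
    have h2 : AnalyticAt ℂ (fun q : Amb => M q.2) 0 :=
      AnalyticAt.fun_comp (x := (0 : Amb)) (g := M) (f := fun q : Amb => q.2) hM analyticAt_snd
    exact hV1.sub (h1.add (analyticAt_fst.mul h2))
  refine (eventually_zero_of_slices hg ?_).mono fun q hq => sub_eq_zero.1 hq
  filter_upwards [key] with w hw
  filter_upwards [hw] with z hz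
  exact sub_eq_zero.2 hz

end

/-! ### The system of differential equations for the restricted coefficients -/

/-- The combination of `P`, `M` and their conjugates with coefficients `α`. -/
noncomputable def comb (α : Fin 4 → ℂ) (P M : (Fin 8 → ℂ) → ℂ) (w : Fin 8 → ℂ) : ℂ :=
  (α 0 * P w + α 1 * M w) + (α 2 * conjFun P w + α 3 * conjFun M w)

/-- The coefficients of the conjugate of a combination. -/
def conjCoef (α : Fin 4 → ℂ) : Fin 4 → ℂ := ![star (α 2), star (α 3), star (α 0), star (α 1)]

section
variable {P M : (Fin 8 → ℂ) → ℂ}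

/-- The combinations of `P, M, P̄, M̄` are closed under conjugation, so solving the paired equations
reduces to arithmetic with coefficient vectors. -/
theorem conjFun_comb (α : Fin 4 → ℂ) (w : Fin 8 → ℂ) :
    conjFun (comb α P M) w = comb (conjCoef α) P M w := by
  simp only [conjFun, comb, conjCoef, star_add, star_mul', star_star, Matrix.cons_val_zero,
    Matrix.cons_val_one, Matrix.cons_val]
  ring

theorem analyticAt_conjFun_zero {g : (Fin 8 → ℂ) → ℂ} (hg : AnalyticAt ℂ g 0) :
    AnalyticAt ℂ (conjFun g) 0 :=
  analyticAt_conjFun (by rwa [star_zero])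

theorem analyticAt_comb (hP : AnalyticAt ℂ P 0) (hM : AnalyticAt ℂ M 0) (α : Fin 4 → ℂ) :
    AnalyticAt ℂ (comb α P M) 0 :=
  ((analyticAt_const.mul hP).add (analyticAt_const.mul hM)).add
    ((analyticAt_const.mul (analyticAt_conjFun_zero hP)).add
      (analyticAt_const.mul (analyticAt_conjFun_zero hM)))

theorem flat_comb (hP : AnalyticAt ℂ P 0) (hM : AnalyticAt ℂ M 0) {i : Fin 8} (fP : Flat i P)
    (fM : Flat i M) (α : Fin 4 → ℂ) : Flat i (comb α P M) := by
  have h1 := Flat.add_mul hP hM (α 0) (α 1) fP fM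
  have h2 := Flat.add_mul (analyticAt_conjFun_zero hP) (analyticAt_conjFun_zero hM) (α 2) (α 3)
    (fP.conj hP) (fM.conj hM)
  have h3 := Flat.add_mul ((analyticAt_const.mul hP).add (analyticAt_const.mul hM))
    ((analyticAt_const.mul (analyticAt_conjFun_zero hP)).add
      (analyticAt_const.mul (analyticAt_conjFun_zero hM))) 1 1 h1 h2
  refine h3.congr (.of_forall fun w => ?_)
  simp only [comb, Pi.add_apply, Pi.mul_apply]
  ring

end

/-- The coefficients of `2 i ∂_1 A_j`. -/
noncomputable def coef1 : Fin 8 → Fin 4 → ℂ :=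
  ![![0, 2 * I, 0, 2 * I], ![4 * I, 0, 4 * I, 0], ![4, 0, -4, 0], 0, 0, 0, 0, 0]

/-- The coefficients of `2 i ∂_2 A_j + 2 ∂_3 A_j`. -/
noncomputable def coef23 : Fin 8 → Fin 4 → ℂ :=
  ![0, ![0, 4 * I, 0, 2 * I], ![0, 4, 0, 2], ![6 * I, 0, 0, 0], ![6, 0, 0, 0], ![0, 0, 4 * I, 0],
    0, 0]

/-- The coefficients of `2 i ∂_4 A_j + 2 ∂_5 A_j`. -/
noncomputable def coef45 : Fin 8 → Fin 4 → ℂ :=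
  ![0, 0, 0, ![0, 6 * I, 0, 2 * I], ![0, 6, 0, 2], 0, ![0, 0, 4 * I, 0], ![0, 0, 4, 0]]

/-- The coefficients of `2 i ∂_6 A_j`. -/
noncomputable def coef6 : Fin 8 → Fin 4 → ℂ :=
  ![0, 0, 0, 0, 0, ![0, 4 * I, 0, 4 * I], ![6 * I, 0, 6 * I, 0], ![6, 0, -6, 0]]

/-- The coefficients of `2 i ∂_7 A_j + 2 ∂_8 A_j`. -/
noncomputable def coef78 : Fin 8 → Fin 4 → ℂ :=
  ![0, 0, 0, 0, 0, 0, ![0, 6 * I, 0, 4 * I], ![0, 6, 0, 4]]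

/-- A tangent vector field whose `Z`-coefficient is `Z(0, w) + z M(w)`. -/
structure AffineTangent (V : Amb → Amb) (M : (Fin 8 → ℂ) → ℂ) : Prop where
  analytic : AnalyticAt ℂ V 0
  tangent : IsTangent V
  analytic_M : AnalyticAt ℂ M 0
  eq : ∀ᶠ q : Amb in 𝓝 0, (V q).1 = restrZ V q.2 + q.1 * M q.2

theorem eventually_slices {p : Amb → Prop} (h : ∀ᶠ q in 𝓝 0, p q) :
    ∀ᶠ w : Fin 8 → ℂ in 𝓝 0, ∀ᶠ z : ℂ in 𝓝 0, p (z, w) := by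
  have h1 : Tendsto (fun q : (Fin 8 → ℂ) × ℂ => ((q.2, q.1) : Amb)) (𝓝 0) (𝓝 0) := by
    have : Continuous fun q : (Fin 8 → ℂ) × ℂ => ((q.2, q.1) : Amb) := by fun_prop
    exact this.tendsto 0
  exact (h1.eventually h).curry_nhds

theorem sum_xi1_eq_zero {a : Fin 8 → ℂ} (h : ∀ k < 5, a k = 0) (z : ℂ) :
    ∑ k, xi1 z k * a k = 0 := by
  simp only [Fin.sum_univ_eight]
  rw [h 0 (by decide), h 1 (by decide), h 2 (by decide), h 3 (by decide), h 4 (by decide)]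
  simp [xi1]

namespace AffineTangent
variable {V : Amb → Amb} {M : (Fin 8 → ℂ) → ℂ}

/-- The order-two part is conditional: the vanishing it assumes is deduced from the order-one part,
in `second_order`. -/
theorem equations (h : AffineTangent V M) : ∀ᶠ w : Fin 8 → ℂ in 𝓝 0, ∀ᶠ z : ℂ in 𝓝 0, ∀ j,
    (∑ k, xi1 z k * pd k (restrW V j) w + xiZ1 0 j * restrZ V w
      = xiZ1 z j * (restrZ V w + z * M w) + xi1 z j * conjFun M w
        + xiY1 z j * conjFun (restrZ V) w) ∧
    ((∀ k < 5, ∀ l < 5, pd l (pd k (restrW V j)) w = 0) →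
      (∀ k < 5, ∀ l < 5, pd l (pd k (conjFun (restrZ V))) w = 0) →
      (∀ k < 5, pd k (conjFun M) w = 0) →
      ∑ k, xi2 z k * pd k (restrW V j) w + xiZ2 0 j * restrZ V w
        = xiZ2 z j * (restrZ V w + z * M w)
          - xi1 z j * ∑ k, xi2 z k * pd k (conjFun (restrZ V)) w
          + xiY1 z j * conjFun M w + xiY2 z j * conjFun (restrZ V) w) := by
  have hP := analyticAt_restrZ h.analytic
  have hc : ∀ᶠ q : Amb in 𝓝 0,
      (conjFun V q).1 = conjFun (restrZ V) q.2 + q.1 * conjFun M q.2 := by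
    filter_upwards [eventually_star h.eq] with q hq
    have h1 := congrArg star hq
    rw [star_add, star_mul', Prod.fst_star, star_star] at h1
    exact h1
  filter_upwards [tangency_restricted h.analytic h.tangent, eventually_slices h.eq,
    eventually_all.2 fun j => (analyticAt_restrW h.analytic j).eventually_analyticAt,
    hP.eventually_analyticAt, (analyticAt_conjFun_zero hP).eventually_analyticAt,
    (analyticAt_conjFun_zero h.analytic_M).eventually_analyticAt,
    eventually_slice hc.eventually_nhds,
    eventually_all.2 fun k : Fin 8 => eventually_all.2 fun hk : k < 5 =>
      flat_conjFun_restrZ h.analytic h.tangent k hk,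
    eventually_all.2 fun k : Fin 8 => eventually_all.2 fun hk : k < 5 =>
      flat_restrZ h.analytic h.tangent k hk]
    with w e1 e2 hA hP hQ hN hcw fQ fP
  filter_upwards [e1, e2] with z hz hz' j
  have hX : ∀ k, AnalyticAt ℂ (fun s => XiP z s k) 0 := fun k =>
    analyticAt_XiP analyticAt_const analyticAt_id k
  have jQ := HasJet.comp_sub hQ hX (hasJet_XiP z)
  have jN := HasJet.comp_sub hN hX (hasJet_XiP z)
  -- This is the jet of `P̄ + y M̄` along the curve. Its linear coefficient is `M̄(w)` alone,
  -- because `P̄` does not depend on `w^1, …, w^5`.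
  have jY := jQ.add (HasJet.id.mul jN)
  rw [sum_xi1_eq_zero fQ, zero_mul, add_zero] at jY
  have ht : Tendsto (fun y : ℂ => ((y, w - XiP z y) : Amb)) (𝓝 0) (𝓝 (0, w)) := by
    have h1 : AnalyticAt ℂ (fun y : ℂ => ((y, w - XiP z y) : Amb)) 0 :=
      analyticAt_id.prod (analyticAt_const.sub (analyticAt_vec_XiP analyticAt_const analyticAt_id))
    have h2 := h1.continuousAt.tendsto
    rwa [XiP_zero_right, sub_zero] at h2
  have hj := jet_equations (hA j) hP jY (j := j) (Z := (V (z, w)).1) (by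
    filter_upwards [hz, ht.eventually hcw] with y h1 h2
    rw [h1 j, h2])
  rw [hz', sum_xi1_eq_zero fP] at hj
  refine ⟨by linear_combination hj.1, fun s1 s2 s3 => ?_⟩
  have h2 := hj.2
  rw [sum_xi1_eq_zero fun k hk => sum_xi1_eq_zero (s1 k hk) z,
    sum_xi1_eq_zero fun k hk => sum_xi1_eq_zero (s2 k hk) z, sum_xi1_eq_zero s3] at h2
  linear_combination h2

theorem first_relations (h : AffineTangent V M) (j : Fin 8) : ∀ᶠ w in 𝓝 0,
    2 * I * pd 0 (restrW V j) w = comb (coef1 j) (restrZ V) M w ∧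
    2 * I * pd 1 (restrW V j) w + 2 * pd 2 (restrW V j) w = comb (coef23 j) (restrZ V) M w ∧
    2 * I * pd 3 (restrW V j) w + 2 * pd 4 (restrW V j) w = comb (coef45 j) (restrZ V) M w := by
  filter_upwards [h.equations] with w hw
  refine coeffs_xi1 (r0 := 0) (r4 := 0) (a := fun k => pd k (restrW V j) w)
    (hw.mono fun z hz => ?_)
  have h1 := (hz j).1
  have h2 : ∑ k, xi1 z k * pd k (restrW V j) w = xiZ1 z j * (restrZ V w + z * M w)
    + xi1 z j * conjFun M w + xiY1 z j * conjFun (restrZ V) w - xiZ1 0 j * restrZ V w := by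
    linear_combination h1
  rw [h2]
  clear h1 h2 hz hw
  fin_cases j <;>
  · simp [xiZ1, xi1, xiY1, comb, coef1, coef23, coef45]
    try ring

end AffineTangent

theorem lt_five_cases {k : Fin 8} (hk : k < 5) : k = 0 ∨ k = 1 ∨ k = 2 ∨ k = 3 ∨ k = 4 := by
  revert k
  decide

theorem pd_pair_comb {A P M : (Fin 8 → ℂ) → ℂ} {k l : Fin 8} {α : Fin 4 → ℂ}
    (hA : AnalyticAt ℂ A 0) (hr : conjFun A =ᶠ[𝓝 0] A)
    (h : ∀ᶠ w in 𝓝 0, 2 * I * pd k A w + 2 * pd l A w = comb α P M w) :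
    (∀ᶠ w in 𝓝 0, pd k A w = comb (-(I / 4) • (α - conjCoef α)) P M w) ∧
      ∀ᶠ w in 𝓝 0, pd l A w = comb ((1 / 4 : ℂ) • (α + conjCoef α)) P M w := by
  have h1 := pd_pair hA hr h
  constructor <;>
  · filter_upwards [h1] with w hw
    first | rw [hw.1] | rw [hw.2]
    rw [conjFun_comb]
    simp only [comb, Pi.smul_apply, Pi.sub_apply, Pi.add_apply, smul_eq_mul]
    ring

theorem pd_single_comb {A P M : (Fin 8 → ℂ) → ℂ} {k : Fin 8} {α : Fin 4 → ℂ}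
    (h : ∀ᶠ w in 𝓝 0, 2 * I * pd k A w = comb α P M w) :
    ∀ᶠ w in 𝓝 0, pd k A w = comb (-(I / 2) • α) P M w := by
  filter_upwards [h] with w hw
  have h1 : pd k A w = -(I / 2) * comb α P M w := by
    linear_combination -(I / 2) * hw + pd k A w * I_sq
  rw [h1]
  simp only [comb, Pi.smul_apply, smul_eq_mul]
  ring

/-- The coefficients of the partial derivatives of `A_j`. -/
noncomputable def pdCoef (j : Fin 8) : Fin 8 → Fin 4 → ℂ :=
  ![-(I / 2) • coef1 j,
    -(I / 4) • (coef23 j - conjCoef (coef23 j)), (1 / 4 : ℂ) • (coef23 j + conjCoef (coef23 j)),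
    -(I / 4) • (coef45 j - conjCoef (coef45 j)), (1 / 4 : ℂ) • (coef45 j + conjCoef (coef45 j)),
    -(I / 2) • coef6 j,
    -(I / 4) • (coef78 j - conjCoef (coef78 j)), (1 / 4 : ℂ) • (coef78 j + conjCoef (coef78 j))]

/-- This ties the tables of coefficients to the explicit formulas, with `P = c + i d` and `M = a + i
b`. -/
theorem affine_eq_generalField (t : Fin 8 → ℝ) (a b c d : ℝ) (q : Amb) (j : Fin 8) :
    t j + ∑ k, q.2 k * ((pdCoef j k 0 * (c + I * d) + pdCoef j k 1 * (a + I * b))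
        + (pdCoef j k 2 * (c - I * d) + pdCoef j k 3 * (a - I * b))) + xi1 q.1 j * (c - I * d)
      = (generalField t a b c d q).2 j := by
  simp only [Fin.sum_univ_eight]
  fin_cases j <;>
  · simp [pdCoef, coef1, coef23, coef45, coef6, coef78, conjCoef, xi1, generalField]
    ring_nf
    simp only [I_sq, show I ^ 3 = -I by rw [pow_succ, I_sq]; ring,
      show I ^ 4 = 1 from I_pow_four]
    try ring

namespace AffineTangent
variable {V : Amb → Amb} {M : (Fin 8 → ℂ) → ℂ}

theorem pd_restrW (h : AffineTangent V M) (j : Fin 8) {k : Fin 8} (hk : k < 5) :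
    ∀ᶠ w in 𝓝 0, pd k (restrW V j) w = comb (pdCoef j k) (restrZ V) M w := by
  have hA := analyticAt_restrW h.analytic j
  have hr := conjFun_restrW_eq h.analytic h.tangent j
  have h1 := h.first_relations j
  have p1 := pd_single_comb (h1.mono fun w hw => hw.1)
  have p2 := pd_pair_comb hA hr (h1.mono fun w hw => hw.2.1)
  have p3 := pd_pair_comb hA hr (h1.mono fun w hw => hw.2.2)
  obtain rfl | rfl | rfl | rfl | rfl := lt_five_cases hk
  exacts [p1, p2.1, p2.2, p3.1, p3.2]

theorem pd_restrW_zero (h : AffineTangent V M) (j : Fin 8) {k : Fin 8} (hk : k < 5)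
    (h0 : pdCoef j k = 0) : ∀ᶠ w in 𝓝 0, pd k (restrW V j) w = 0 := by
  filter_upwards [h.pd_restrW j hk] with w hw
  rw [hw, h0]
  simp [comb]

/-- `M` is recovered here from `A_2`, and in `M_eq_3` from `A_4`. Both expressions are needed, since
each one settles only some directions in `flat_M`. -/
theorem M_eq_1 (h : AffineTangent V M) : ∀ᶠ w in 𝓝 0,
    M w = (1 / 3) * pd 1 (restrW V 1) w + (-I) * pd 2 (restrW V 1) w := by
  filter_upwards [h.pd_restrW 1 (k := 1) (by decide), h.pd_restrW 1 (k := 2) (by decide)]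
    with w h1 h2
  rw [h1, h2]
  simp [comb, pdCoef, coef23, conjCoef]
  ring_nf
  simp [I_sq]

theorem M_eq_3 (h : AffineTangent V M) : ∀ᶠ w in 𝓝 0,
    M w = (1 / 4) * pd 3 (restrW V 3) w + (-(I / 2)) * pd 4 (restrW V 3) w := by
  filter_upwards [h.pd_restrW 3 (k := 3) (by decide), h.pd_restrW 3 (k := 4) (by decide)]
    with w h1 h2
  rw [h1, h2]
  simp [comb, pdCoef, coef45, conjCoef]
  ring_nf
  simp [I_sq]

theorem restrZ_eq_3 (h : AffineTangent V M) : ∀ᶠ w in 𝓝 0,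
    restrZ V w = (1 / 3) * pd 1 (restrW V 3) w + (-(I / 3)) * pd 2 (restrW V 3) w := by
  filter_upwards [h.pd_restrW 3 (k := 1) (by decide), h.pd_restrW 3 (k := 2) (by decide)]
    with w h1 h2
  rw [h1, h2]
  simp [comb, pdCoef, coef23, conjCoef]
  ring_nf
  simp [I_sq]

/-- A combination without `M`-terms does not depend on `w^1, …, w^5`. -/
theorem flat_comb_restrZ (h : AffineTangent V M) {l : Fin 8} (hl : l < 5) {α : Fin 4 → ℂ}
    (h1 : α 1 = 0) (h3 : α 3 = 0) : Flat l (comb α (restrZ V) M) := by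
  refine (flat_comb (analyticAt_restrZ h.analytic) (M := fun _ => 0) analyticAt_const
    (flat_restrZ h.analytic h.tangent l hl) (flat_zero l) α).congr (.of_forall fun w => ?_)
  simp [comb, h1, h3]

/-- Direction `w^1`: `M` comes from `∂_2 A_2, ∂_3 A_2`, and `∂_1 A_2` involves only `P, P̄`.
Directions `w^2, w^3`: `M` comes from `∂_4 A_4, ∂_5 A_4`, and `∂_2 A_4, ∂_3 A_4` involve only `P,
P̄`. Directions `w^4, w^5`: `A_2` does not depend on them. -/
theorem flat_M (h : AffineTangent V M) {k : Fin 8} (hk : k < 5) : Flat k M := by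
  have hA := analyticAt_restrW h.analytic
  obtain rfl | rfl | rfl | rfl | rfl := lt_five_cases hk
  · refine flat_of_comb (hA 1) h.M_eq_1 (h.pd_restrW 1 hk) ?_ ?_ <;>
      exact h.flat_comb_restrZ (by decide) (by simp [pdCoef, coef1]) (by simp [pdCoef, coef1])
  · refine flat_of_comb (hA 3) h.M_eq_3 (h.pd_restrW 3 hk) ?_ ?_ <;>
      exact h.flat_comb_restrZ (by decide) (by simp [pdCoef, coef23, conjCoef])
        (by simp [pdCoef, coef23, conjCoef])
  · refine flat_of_comb (hA 3) h.M_eq_3 (h.pd_restrW 3 hk) ?_ ?_ <;>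
      exact h.flat_comb_restrZ (by decide) (by simp [pdCoef, coef23, conjCoef])
        (by simp [pdCoef, coef23, conjCoef])
  · refine flat_of_comb (hA 1) h.M_eq_1 (h.pd_restrW_zero 1 hk ?_) (flat_zero _) (flat_zero _)
    funext i
    fin_cases i <;> simp [pdCoef, coef45, conjCoef]
  · refine flat_of_comb (hA 1) h.M_eq_1 (h.pd_restrW_zero 1 hk ?_) (flat_zero _) (flat_zero _)
    funext i
    fin_cases i <;> simp [pdCoef, coef45, conjCoef]

theorem second_order (h : AffineTangent V M) : ∀ᶠ w : Fin 8 → ℂ in 𝓝 0, ∀ᶠ z : ℂ in 𝓝 0, ∀ j,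
    ∑ k, xi2 z k * pd k (restrW V j) w + xiZ2 0 j * restrZ V w
      = xiZ2 z j * (restrZ V w + z * M w)
        - xi1 z j * ∑ k, xi2 z k * pd k (conjFun (restrZ V)) w
        + xiY1 z j * conjFun M w + xiY2 z j * conjFun (restrZ V) w := by
  have hP := analyticAt_restrZ h.analytic
  have s1 : ∀ j, ∀ k < 5, ∀ l < 5, Flat l (pd k (restrW V j)) := fun j k hk l hl =>
    (flat_comb hP h.analytic_M (flat_restrZ h.analytic h.tangent l hl) (h.flat_M hl)
      (pdCoef j k)).congr ((h.pd_restrW j hk).mono fun w hw => hw.symm)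
  have s2 : ∀ k < 5, ∀ l < 5, Flat l (pd k (conjFun (restrZ V))) := fun k hk l hl =>
    (flat_zero l).congr ((flat_conjFun_restrZ h.analytic h.tangent k hk).mono fun w hw => hw.symm)
  have s3 : ∀ k < 5, Flat k (conjFun M) := fun k hk => (h.flat_M hk).conj h.analytic_M
  have s1' := eventually_all.2 fun j => eventually_all.2 fun k : Fin 8 => eventually_all.2
    fun hk : k < 5 => eventually_all.2 fun l : Fin 8 => eventually_all.2 fun hl : l < 5 =>
      s1 j k hk l hl
  have s2' := eventually_all.2 fun k : Fin 8 => eventually_all.2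
    fun hk : k < 5 => eventually_all.2 fun l : Fin 8 => eventually_all.2 fun hl : l < 5 =>
      s2 k hk l hl
  have s3' := eventually_all.2 fun k : Fin 8 => eventually_all.2 fun hk : k < 5 => s3 k hk
  filter_upwards [h.equations, s1', s2', s3'] with w hw e1 e2 e3
  filter_upwards [hw] with z hz j
  exact (hz j).2 (e1 j) e2 e3

/-- In the order-two equation for `W^4` the still unknown derivatives of `P̄` in `w^6, w^7, w^8` are
multiplied by `xi1 = 2 i z³` and enter only from `z^5` on. The coefficients of `z²` and `z³`
therefore have zero right-hand side. -/
theorem pd_restrW_3_zero (h : AffineTangent V M) {k : Fin 8} (hk : 5 ≤ k) :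
    ∀ᶠ w in 𝓝 0, pd k (restrW V 3) w = 0 := by
  have fQ := eventually_all.2 fun k : Fin 8 => eventually_all.2 fun hk : k < 5 =>
    flat_conjFun_restrZ h.analytic h.tangent k hk
  have h1 : ∀ᶠ w in 𝓝 0, 2 * I * pd 5 (restrW V 3) w = 0 ∧
      2 * I * pd 6 (restrW V 3) w + 2 * pd 7 (restrW V 3) w = 0 := by
    filter_upwards [h.second_order, fQ] with w hw fQ
    refine coeffs_xi2 (a := fun k => pd k (restrW V 3) w) (r0 := 0)
      (r1 := 6 * I * conjFun (restrZ V) w) (r4 := 0)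
      (r5 := -(2 * I * (2 * I * pd 5 (conjFun (restrZ V)) w)))
      (r6 := -(2 * I * (2 * I * pd 6 (conjFun (restrZ V)) w
        + 2 * pd 7 (conjFun (restrZ V)) w))) (hw.mono fun z hz => ?_)
    have h2 := hz 3
    have h3 : ∑ k, xi2 z k * pd k (conjFun (restrZ V)) w
        = 2 * I * z ^ 2 * pd 5 (conjFun (restrZ V)) w
          + z ^ 3 * (2 * I * pd 6 (conjFun (restrZ V)) w + 2 * pd 7 (conjFun (restrZ V)) w) := by
      simp only [Fin.sum_univ_eight]
      rw [fQ 1 (by decide), fQ 2 (by decide)]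
      simp [xi2]
      ring
    rw [h3] at h2
    simp only [xiZ2, xi1, xiY1, xiY2] at h2 ⊢
    simp at h2 ⊢
    linear_combination h2
  have h2 := pd_pair_zero (analyticAt_restrW h.analytic 3)
    (conjFun_restrW_eq h.analytic h.tangent 3) (h1.mono fun w hw => hw.2)
  obtain rfl | rfl | rfl : k = 5 ∨ k = 6 ∨ k = 7 := by
    revert k
    decide
  · filter_upwards [h1] with w hw
    simpa using hw.1
  · exact h2.mono fun w hw => hw.1
  · exact h2.mono fun w hw => hw.2

theorem flat_restrZ_all (h : AffineTangent V M) (k : Fin 8) : Flat k (restrZ V) := by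
  rcases lt_or_ge k 5 with hk | hk
  · exact flat_restrZ h.analytic h.tangent k hk
  · exact flat_of_comb (analyticAt_restrW h.analytic 3) h.restrZ_eq_3 (h.pd_restrW_3_zero hk)
      (flat_zero _) (flat_zero _)

theorem flat_M_all (h : AffineTangent V M) (k : Fin 8) : Flat k M := by
  rcases lt_or_ge k 5 with hk | hk
  · exact h.flat_M hk
  · exact flat_of_comb (analyticAt_restrW h.analytic 3) h.M_eq_3 (h.pd_restrW_3_zero hk)
      (flat_zero _) (flat_zero _)

theorem second_relations (h : AffineTangent V M) (j : Fin 8) : ∀ᶠ w in 𝓝 0,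
    2 * I * pd 5 (restrW V j) w = comb (coef6 j) (restrZ V) M w ∧
    2 * I * pd 6 (restrW V j) w + 2 * pd 7 (restrW V j) w = comb (coef78 j) (restrZ V) M w := by
  have fQ := eventually_all.2 fun k : Fin 8 =>
    (h.flat_restrZ_all k).conj (analyticAt_restrZ h.analytic)
  filter_upwards [h.second_order, fQ] with w hw fQ
  -- The coefficients of `z` on the right-hand side; they only complete the polynomial, and the
  -- relation they express is not used.
  let r1 : Fin 8 → ℂ := ![0, 2 * I * M w + 4 * I * conjFun M w, -2 * M w - 4 * conjFun M w,
    6 * I * conjFun (restrZ V) w, -6 * conjFun (restrZ V) w, 4 * I * restrZ V w, 0, 0]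
  refine coeffs_xi2 (a := fun k => pd k (restrW V j) w) (r0 := 0) (r1 := r1 j) (r4 := 0)
    (r5 := 0) (r6 := 0) (hw.mono fun z hz => ?_)
  have h1 := hz j
  have h3 : ∑ k, xi2 z k * pd k (conjFun (restrZ V)) w = 0 :=
    Finset.sum_eq_zero fun k _ => by rw [fQ k, mul_zero]
  have h2 : ∑ k, xi2 z k * pd k (restrW V j) w = xiZ2 z j * (restrZ V w + z * M w)
      + xiY1 z j * conjFun M w + xiY2 z j * conjFun (restrZ V) w - xiZ2 0 j * restrZ V w := by
    rw [h3] at h1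
    linear_combination h1
  rw [h2]
  clear h1 h2 h3 hz hw
  fin_cases j <;>
  · simp [xiZ2, xiY1, xiY2, comb, coef6, coef78, r1]
    try ring

theorem pd_restrW_all (h : AffineTangent V M) (j k : Fin 8) :
    ∀ᶠ w in 𝓝 0, pd k (restrW V j) w = comb (pdCoef j k) (restrZ V) M w := by
  have h1 := h.second_relations j
  have p1 := pd_single_comb (h1.mono fun w hw => hw.1)
  have p2 := pd_pair_comb (analyticAt_restrW h.analytic j)
    (conjFun_restrW_eq h.analytic h.tangent j) (h1.mono fun w hw => hw.2)
  rcases lt_or_ge k 5 with hk | hk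
  · exact h.pd_restrW j hk
  · obtain rfl | rfl | rfl : k = 5 ∨ k = 6 ∨ k = 7 := by
      revert k
      decide
    exacts [p1, p2.1, p2.2]

/-- The tangent vector fields have the general coefficients. -/
theorem eq_generalField (h : AffineTangent V M) :
    ∃ (t : Fin 8 → ℝ) (a b c d : ℝ), V =ᶠ[𝓝 0] generalField t a b c d := by
  have hP := analyticAt_restrZ h.analytic
  have cP := Flat.eq_const hP h.flat_restrZ_all
  have cM := Flat.eq_const h.analytic_M h.flat_M_all
  have hc : ∀ (α : Fin 4 → ℂ), ∀ᶠ w in 𝓝 0, comb α (restrZ V) M w = comb α (restrZ V) M 0 :=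
    fun α => Flat.eq_const (analyticAt_comb hP h.analytic_M α) fun k =>
      flat_comb hP h.analytic_M (h.flat_restrZ_all k) (h.flat_M_all k) α
  have hA : ∀ j, ∀ᶠ w in 𝓝 0, restrW V j w
      = restrW V j 0 + ∑ k, w k * comb (pdCoef j k) (restrZ V) M 0 := fun j =>
    eq_affine_of_pd (analyticAt_restrW h.analytic j) fun k => by
      filter_upwards [h.pd_restrW_all j k, hc (pdCoef j k)] with w h1 h2
      rw [h1, h2]
  have ht : ∀ j, restrW V j 0 = ((restrW V j 0).re : ℂ) := fun j => by
    have h1 := (conjFun_restrW_eq h.analytic h.tangent j).self_of_nhds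
    simp only [conjFun, star_zero] at h1
    exact (Complex.conj_eq_iff_re.1 h1).symm
  have hsnd : Tendsto (fun q : Amb => q.2) (𝓝 0) (𝓝 0) := continuous_snd.tendsto (0 : Amb)
  -- The constants are `c_j = A_j(0)`, which is real, `a + i b = M(0)` and `c + i d = Z(0, 0)`.
  refine ⟨fun j => (restrW V j 0).re, (M 0).re, (M 0).im, (restrZ V 0).re, (restrZ V 0).im, ?_⟩
  have eP : restrZ V 0 = (restrZ V 0).re + I * (restrZ V 0).im := by
    rw [mul_comm]; exact (Complex.re_add_im _).symm
  have eM : M 0 = (M 0).re + I * (M 0).im := by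
    rw [mul_comm]; exact (Complex.re_add_im _).symm
  have eP' : conjFun (restrZ V) 0 = (restrZ V 0).re - I * (restrZ V 0).im := by
    conv_lhs => rw [conjFun, star_zero, eP]
    simp
    ring
  have eM' : conjFun M 0 = (M 0).re - I * (M 0).im := by
    conv_lhs => rw [conjFun, star_zero, eM]
    simp
    ring
  filter_upwards [h.eq, eventually_V_eq' h.analytic h.tangent, hsnd.eventually cP,
    hsnd.eventually cM, hsnd.eventually ((Flat.eq_const (analyticAt_conjFun_zero hP) fun k =>
      (h.flat_restrZ_all k).conj hP)), hsnd.eventually (eventually_all.2 hA)]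
    with q e1 e2 e3 e4 e5 e6
  refine Prod.ext ?_ (funext fun j => ?_)
  · rw [e1, e3, e4]
    simp only [generalField]
    rw [← eP, ← eM]
    ring
  · have h1 := affine_eq_generalField (fun j => (restrW V j 0).re) (M 0).re (M 0).im
      (restrZ V 0).re (restrZ V 0).im q j
    rw [← eP, ← eM, ← eP', ← eM', ← ht] at h1
    rw [e2, e5, e6, ← h1]
    rfl

end AffineTangent

/-! ### The infinitesimal CR-automorphisms -/

theorem analyticAt_generalField (t : Fin 8 → ℝ) (a b c d : ℝ) (p : Amb) :
    AnalyticAt ℂ (generalField t a b c d) p := by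
  have hz : AnalyticAt ℂ (fun p : Amb => p.1) p := analyticAt_fst
  have hw : ∀ k, AnalyticAt ℂ (fun p : Amb => p.2 k) p := fun k =>
    analyticAt_pi_iff.1 analyticAt_snd k
  refine AnalyticAt.prod ?_ (analyticAt_pi_iff.2 fun j => ?_)
  · fun_prop
  · fin_cases j <;> simp <;> fun_prop

theorem isTangent_generalField (t : Fin 8 → ℝ) (a b c d : ℝ) :
    IsTangent (generalField t a b c d) := by
  refine .of_forall fun p hp j => ?_
  -- On the model `conj w` can be eliminated, after which tangency is a polynomial identity in `z`,
  -- `conj z` and `w`.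
  have hw : ∀ k, starRingEnd ℂ (p.2 k) = p.2 k - XiP p.1 (starRingEnd ℂ p.1) k := fun k => by
    have h1 : p.2 k - starRingEnd ℂ (p.2 k) - XiP p.1 (starRingEnd ℂ p.1) k = 0 := hp k
    linear_combination -h1
  rw [fderiv_rho_eq]
  have hI : I ^ 2 = -1 := I_sq
  fin_cases j <;>
  · simp [generalField, hw, XiP, XiZ, XiY]
    ring_nf
    try simp only [hI]
    try ring

theorem exists_generalField {V : Amb → Amb} (hV : AnalyticAt ℂ V 0) (tV : IsTangent V) :
    ∃ (t : Fin 8 → ℝ) (a b c d : ℝ), V =ᶠ[𝓝 0] generalField t a b c d := by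
  obtain ⟨M, hM, hZ⟩ := exists_affine_Z hV tV
  exact AffineTangent.eq_generalField ⟨hV, tV, hM, hZ⟩

theorem mem_autCR_iff (V : Amb → Amb) :
    (∃ h : (V : Germ (𝓝 (0 : Amb)) Amb) ∈ HolVF,
      (⟨(V : Germ (𝓝 (0 : Amb)) Amb), h⟩ : HolVF) ∈ autCR) ↔
    ∃ (t : Fin 8 → ℝ) (a b c d : ℝ), V =ᶠ[𝓝 0] generalField t a b c d := by
  constructor
  · rintro ⟨⟨U, hU, hVU⟩, W, hVW, tW⟩
    -- Analyticity and tangency are witnessed by possibly different representatives `U` and `W`;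
    -- both transfer to `V` near the origin.
    have e1 : V =ᶠ[𝓝 0] U := Germ.coe_eq.1 hVU
    have e2 : V =ᶠ[𝓝 0] W := Germ.coe_eq.1 hVW
    exact exists_generalField (hU.congr e1.symm) (tW.congr e2.symm)
  · rintro ⟨t, a, b, c, d, h⟩
    exact ⟨⟨_, analyticAt_generalField t a b c d 0, Germ.coe_eq.2 h⟩, _, Germ.coe_eq.2 h,
      isTangent_generalField t a b c d⟩

/-! ### Linear coordinates on the algebra -/

/-- The general vector field with the constants collected in one vector. -/
noncomputable def fieldOf (x : Fin 12 → ℝ) : Amb → Amb :=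
  generalField ![x 0, x 1, x 2, x 3, x 4, x 5, x 6, x 7] (x 8) (x 9) (x 10) (x 11)

theorem fieldOf_add (x y : Fin 12 → ℝ) : fieldOf (x + y) = fieldOf x + fieldOf y := by
  funext p
  refine Prod.ext ?_ (funext fun j => ?_)
  · simp [fieldOf, generalField]
    ring
  · fin_cases j <;>
    · simp [fieldOf, generalField]
      ring

theorem fieldOf_smul (r : ℝ) (x : Fin 12 → ℝ) : fieldOf (r • x) = r • fieldOf x := by
  funext p
  refine Prod.ext ?_ (funext fun j => ?_)
  · simp [fieldOf, generalField]
    ring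
  · fin_cases j <;>
    · simp [fieldOf, generalField]
      try ring

theorem fieldOf_eq_sum (x : Fin 12 → ℝ) (p : Amb) :
    fieldOf x p = ∑ i, x i • basisField i p := by
  obtain ⟨z, w⟩ := p
  refine Prod.ext ?_ (funext fun j => ?_)
  · simp [fieldOf, generalField, basisField, Fin.sum_univ_succ]
    ring
  · fin_cases j <;>
    · simp [fieldOf, generalField, basisField, Fin.sum_univ_succ]
      simp [Matrix.vecHead, Matrix.vecTail]
      ring

theorem fieldOf_single (i : Fin 12) : fieldOf (Pi.single i 1) = basisField i := by
  funext p
  simp [fieldOf_eq_sum, Pi.single_apply]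

/-- The infinitesimal CR-automorphism with given constants. -/
noncomputable def autOf : (Fin 12 → ℝ) →ₗ[ℝ] autCR where
  toFun x := ⟨⟨(fieldOf x : Germ (𝓝 (0 : Amb)) Amb), _, analyticAt_generalField _ _ _ _ _ 0, rfl⟩,
    _, rfl, isTangent_generalField _ _ _ _ _⟩
  map_add' x y := by
    refine Subtype.ext (Subtype.ext ?_)
    change (fieldOf (x + y) : Germ (𝓝 (0 : Amb)) Amb) = _
    rw [fieldOf_add]
    rfl
  map_smul' r x := by
    refine Subtype.ext (Subtype.ext ?_)
    change (fieldOf (r • x) : Germ (𝓝 (0 : Amb)) Amb) = _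
    rw [fieldOf_smul]
    rfl

theorem coe_autOf (x : Fin 12 → ℝ) :
    ((autOf x : HolVF) : Germ (𝓝 (0 : Amb)) Amb) = (fieldOf x : Germ (𝓝 (0 : Amb)) Amb) := rfl

theorem autOf_surjective : Function.Surjective autOf := by
  rintro ⟨⟨_, V, hV, rfl⟩, W, hVW, tW⟩
  have e : V =ᶠ[𝓝 0] W := Germ.coe_eq.1 hVW
  obtain ⟨t, a, b, c, d, h⟩ := exists_generalField hV (tW.congr e.symm)
  refine ⟨![t 0, t 1, t 2, t 3, t 4, t 5, t 6, t 7, a, b, c, d],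
    Subtype.ext (Subtype.ext (Germ.coe_eq.2 ?_))⟩
  have ht : fieldOf ![t 0, t 1, t 2, t 3, t 4, t 5, t 6, t 7, a, b, c, d]
      = generalField t a b c d := by
    have h1 : ![t 0, t 1, t 2, t 3, t 4, t 5, t 6, t 7] = t := by
      funext j
      fin_cases j <;> rfl
    simp [fieldOf, h1]
  rw [ht]
  exact h.symm

/-- The values at the origin give `c_1, …, c_8`, and `Z` on the line `w = 0` gives `c + i d` and `a
+ i b`. -/
theorem autOf_injective : Function.Injective autOf := by
  rw [← LinearMap.ker_eq_bot, LinearMap.ker_eq_bot']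
  intro x hx
  have h1 : fieldOf x =ᶠ[𝓝 0] 0 :=
    Germ.coe_eq.1 (congrArg (fun X : autCR => ((X : HolVF) : Germ (𝓝 (0 : Amb)) Amb)) hx)
  have h2 : ∀ j, (fieldOf x 0).2 j = 0 := fun j => by rw [h1.self_of_nhds]; rfl
  have hc : Tendsto (fun z : ℂ => ((z, 0) : Amb)) (𝓝 0) (𝓝 0) := by
    have : Continuous fun z : ℂ => ((z, 0) : Amb) := by fun_prop
    exact this.tendsto 0
  have h3 := eq_zero_of_poly_eq_zero (c0 := x 10 + I * x 11) (c1 := x 8 + I * x 9) (c2 := 0)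
    (c3 := 0) (c4 := 0) (c5 := 0) (c6 := 0) (by
      filter_upwards [hc.eventually h1] with z hz
      have h4 : (fieldOf x (z, 0)).1 = 0 := by rw [hz]; rfl
      simp only [fieldOf, generalField] at h4
      linear_combination h4)
  have r1 := congrArg Complex.re h3.1
  have r2 := congrArg Complex.im h3.1
  have r3 := congrArg Complex.re h3.2.1
  have r4 := congrArg Complex.im h3.2.1
  simp at r1 r2 r3 r4
  have w0 := h2 0
  have w1 := h2 1
  have w2 := h2 2
  have w3 := h2 3
  have w4 := h2 4
  have w5 := h2 5
  have w6 := h2 6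
  have w7 := h2 7
  simp [fieldOf, generalField] at w0 w1 w2 w3 w4 w5 w6 w7
  funext i
  fin_cases i <;> assumption

/-- The basis `X_1, …, X_12`. -/
noncomputable def autBasis : Module.Basis (Fin 12) ℝ autCR :=
  Module.Basis.ofEquivFun (LinearEquiv.ofBijective autOf ⟨autOf_injective, autOf_surjective⟩).symm

theorem autBasis_apply (i : Fin 12) : autBasis i = autOf (Pi.single i 1) := by
  rw [autBasis, Module.Basis.coe_ofEquivFun, LinearEquiv.symm_symm]
  rfl

theorem autBasis_repr_autOf (x : Fin 12 → ℝ) (i : Fin 12) : autBasis.repr (autOf x) i = x i := by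
  have h : (LinearEquiv.ofBijective autOf ⟨autOf_injective, autOf_surjective⟩).symm (autOf x) = x :=
    (LinearEquiv.symm_apply_eq _).2 rfl
  simp [autBasis, h]

theorem coe_autBasis (i : Fin 12) : ((autBasis i : HolVF) : Germ (𝓝 (0 : Amb)) Amb)
    = (basisField i : Germ (𝓝 (0 : Amb)) Amb) := by
  rw [autBasis_apply, coe_autOf, fieldOf_single]

/-! ### The Lie bracket -/

/-- The bracket of infinitesimal CR-automorphisms in terms of the constants. -/
noncomputable def coordBracket (x y : Fin 12 → ℝ) : Fin 12 → ℝ :=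
  let s : Fin 12 → Fin 12 → ℝ := fun i j => x i * y j - x j * y i
  ![4 * s 10 11 + 2 * s 0 8,
    4 * s 0 10 + 3 * s 1 8 - s 2 9,
    4 * s 0 11 + 3 * s 2 8 + s 1 9,
    3 * s 1 10 - 3 * s 2 11 + 4 * s 3 8 - 2 * s 4 9,
    3 * s 1 11 + 3 * s 2 10 + 4 * s 4 8 + 2 * s 3 9,
    2 * s 1 10 + 2 * s 2 11 + 4 * s 5 8,
    2 * s 3 10 + 2 * s 4 11 + 6 * s 5 10 + 5 * s 6 8 - s 7 9,
    -2 * s 3 11 + 2 * s 4 10 + 6 * s 5 11 + s 6 9 + 5 * s 7 8,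
    0,
    0,
    -s 8 10 + s 9 11,
    -s 8 11 - s 9 10]

/-- The derivative of the general vector field at `p` in the direction `v`. -/
noncomputable def jacobian (x : Fin 12 → ℝ) (p v : Amb) : Amb :=
  let a := x 8
  let b := x 9
  let c := x 10
  let d := x 11
  let z := p.1
  let u := v.1
  let w := v.2
  ((a + I * b) * u,
    ![2 * a * w 0 + 2 * (d + I * c) * u,
      4 * c * w 0 + 3 * a * w 1 - b * w 2 + 2 * (d + I * c) * (2 * z * u),
      4 * d * w 0 + b * w 1 + 3 * a * w 2 + 2 * (c - I * d) * (2 * z * u),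
      3 * c * w 1 - 3 * d * w 2 + 4 * a * w 3 - 2 * b * w 4 + 2 * (d + I * c) * (3 * z ^ 2 * u),
      3 * d * w 1 + 3 * c * w 2 + 2 * b * w 3 + 4 * a * w 4 + 2 * (c - I * d) * (3 * z ^ 2 * u),
      2 * c * w 1 + 2 * d * w 2 + 4 * a * w 5,
      2 * c * w 3 + 2 * d * w 4 + 6 * c * w 5 + 5 * a * w 6 - b * w 7,
      -2 * d * w 3 + 2 * c * w 4 + 6 * d * w 5 + b * w 6 + 5 * a * w 7])

/-- The polynomial field is differentiated along the complex line `p + s v`, and uniqueness of the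
derivative identifies the result. -/
theorem fderiv_fieldOf (x : Fin 12 → ℝ) (p v : Amb) :
    fderiv ℂ (fieldOf x) p v = jacobian x p v := by
  have hd : DifferentiableAt ℂ (fieldOf x) p :=
    (analyticAt_generalField _ _ _ _ _ p).differentiableAt
  have hz : HasDerivAt (fun s : ℂ => p.1 + s * v.1) v.1 0 := by
    simpa using ((hasDerivAt_id (0 : ℂ)).mul_const v.1).const_add p.1
  have hw : ∀ k, HasDerivAt (fun s : ℂ => p.2 k + s * v.2 k) (v.2 k) 0 := fun k => by
    simpa using ((hasDerivAt_id (0 : ℂ)).mul_const (v.2 k)).const_add (p.2 k)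
  have hl : HasDerivAt (fun s : ℂ => p + s • v) v 0 := by
    simpa using ((hasDerivAt_id (0 : ℂ)).smul_const v).const_add p
  have h1 : HasDerivAt (fun s : ℂ => fieldOf x (p + s • v)) (fderiv ℂ (fieldOf x) p v) 0 := by
    have h2 : HasFDerivAt (fieldOf x) (fderiv ℂ (fieldOf x) p) (p + (0 : ℂ) • v) := by
      simpa using hd.hasFDerivAt
    exact h2.comp_hasDerivAt (f := fun s : ℂ => p + s • v) (0 : ℂ) hl
  have h2 : HasDerivAt (fun s : ℂ => fieldOf x (p + s • v)) (jacobian x p v) 0 := by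
    refine HasDerivAt.prodMk ?_ (hasDerivAt_pi.2 fun j => ?_)
    · refine ((hz.const_mul _).const_add _).congr_deriv ?_
      simp
    · have q2 : HasDerivAt (fun s : ℂ => (p.1 + s * v.1) ^ 2) (2 * p.1 * v.1) 0 := by
        exact (hz.fun_pow 2).congr_deriv (by simp)
      have q3 : HasDerivAt (fun s : ℂ => (p.1 + s * v.1) ^ 3) (3 * p.1 ^ 2 * v.1) 0 := by
        exact (hz.fun_pow 3).congr_deriv (by simp)
      fin_cases j
      · exact (((hw 0).const_mul _).const_add _).add (hz.const_mul _)
      · exact (((((hw 0).const_mul _).const_add _).add ((hw 1).const_mul _)).sub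
          ((hw 2).const_mul _)).add (q2.const_mul _)
      · exact (((((hw 0).const_mul _).const_add _).add ((hw 1).const_mul _)).add
          ((hw 2).const_mul _)).add (q2.const_mul _)
      · exact ((((((hw 1).const_mul _).const_add _).sub ((hw 2).const_mul _)).add
          ((hw 3).const_mul _)).sub ((hw 4).const_mul _)).add (q3.const_mul _)
      · exact ((((((hw 1).const_mul _).const_add _).add ((hw 2).const_mul _)).add
          ((hw 3).const_mul _)).add ((hw 4).const_mul _)).add (q3.const_mul _)
      · exact ((((hw 1).const_mul _).const_add _).add ((hw 2).const_mul _)).add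
          ((hw 5).const_mul _)
      · exact ((((((hw 3).const_mul _).const_add _).add ((hw 4).const_mul _)).add
          ((hw 5).const_mul _)).add ((hw 6).const_mul _)).sub ((hw 7).const_mul _)
      · refine (((((((hw 3).const_mul _).const_sub _).add ((hw 4).const_mul _)).add
          ((hw 5).const_mul _)).add ((hw 6).const_mul _)).add
          ((hw 7).const_mul _)).congr_deriv ?_
        simp
  exact h1.unique h2

theorem lieBracket_fieldOf (x y : Fin 12 → ℝ) :
    VectorField.lieBracket ℂ (fieldOf x) (fieldOf y) = fieldOf (coordBracket x y) := by
  funext p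
  rw [VectorField.lieBracket_eq]
  simp only [fderiv_fieldOf]
  have hI : I ^ 2 = -1 := I_sq
  refine Prod.ext ?_ (funext fun j => ?_)
  · simp [jacobian, fieldOf, generalField, coordBracket]
    ring_nf
    simp only [hI]
    ring
  · fin_cases j <;>
    · simp [jacobian, fieldOf, generalField, coordBracket]
      ring_nf
      try simp only [hI]
      try ring

theorem autOf_bracket (x y : Fin 12 → ℝ) : ⁅autOf x, autOf y⁆ = autOf (coordBracket x y) := by
  refine Subtype.ext (Subtype.ext ?_)
  rw [coe_autOf, ← lieBracket_fieldOf]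
  rfl

/-! ### The grading and the table of commutators -/

/-- The degrees of the basis vector fields. -/
def degree : Fin 12 → ℤ := ![-2, -3, -3, -4, -4, -4, -5, -5, 0, 0, -1, -1]

theorem gradePiece_eq_span {L : Type*} [AddCommGroup L] [Module ℝ L] (X : Fin 12 → L) (k : ℤ) :
    gradePiece X k = Submodule.span ℝ (X '' {i | degree i = k}) := by
  have key : ∀ (m : ℤ) (s : Set (Fin 12)), (∀ i, i ∈ s ↔ degree i = m) →
      Submodule.span ℝ (X '' {i | degree i = m}) = Submodule.span ℝ (X '' s) := fun m s hs => by
    congr 2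
    ext i
    exact (hs i).symm
  unfold gradePiece
  split_ifs with h1 h2 h3 h4 h5 h6
  · rw [h1, key (-5) {6, 7} (by simp only [Set.mem_insert_iff, Set.mem_singleton_iff]; decide),
      Set.image_pair]
  · rw [h2, key (-4) {3, 4, 5}
      (by simp only [Set.mem_insert_iff, Set.mem_singleton_iff]; decide), Set.image_insert_eq,
      Set.image_pair]
  · rw [h3, key (-3) {1, 2} (by simp only [Set.mem_insert_iff, Set.mem_singleton_iff]; decide),
      Set.image_pair]
  · rw [h4, key (-2) {0} (by simp only [Set.mem_singleton_iff]; decide), Set.image_singleton]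
  · rw [h5, key (-1) {10, 11} (by simp only [Set.mem_insert_iff, Set.mem_singleton_iff]; decide),
      Set.image_pair]
  · rw [h6, key 0 {8, 9} (by simp only [Set.mem_insert_iff, Set.mem_singleton_iff]; decide),
      Set.image_pair]
  · rw [key k ∅ fun i => ⟨fun h => h.elim, fun h => ?_⟩, Set.image_empty, Submodule.span_empty]
    have h7 : ∀ i, degree i = -5 ∨ degree i = -4 ∨ degree i = -3 ∨ degree i = -2
        ∨ degree i = -1 ∨ degree i = 0 := by decide
    have := h7 i
    omega

/-- The pieces are spanned by the members of a basis with a given degree, hence by disjoint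
subfamilies that exhaust it. -/
theorem isInternal_gradePiece : DirectSum.IsInternal (gradePiece autBasis) := by
  rw [DirectSum.isInternal_submodule_iff_iSupIndep_and_iSup_eq_top]
  constructor
  · intro k
    have h1 : ⨆ (l : ℤ) (_ : l ≠ k), gradePiece autBasis l
        ≤ Submodule.span ℝ (autBasis '' {i | degree i ≠ k}) := by
      refine iSup₂_le fun l hl => ?_
      rw [gradePiece_eq_span]
      refine Submodule.span_mono (Set.image_mono fun i hi => ?_)
      rw [Set.mem_ofPred_eq] at hi ⊢
      rwa [hi]
    rw [gradePiece_eq_span]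
    refine Disjoint.mono_right h1 (autBasis.linearIndependent.disjoint_span_image ?_)
    exact Set.disjoint_left.2 fun i hi hi' => hi' hi
  · rw [eq_top_iff, ← autBasis.span_eq, Submodule.span_le]
    rintro _ ⟨i, rfl⟩
    refine Submodule.mem_iSup_of_mem (degree i) ?_
    rw [gradePiece_eq_span]
    exact Submodule.subset_span ⟨i, rfl, rfl⟩

theorem autOf_mem_gradePiece_iff (x : Fin 12 → ℝ) (k : ℤ) :
    autOf x ∈ gradePiece autBasis k ↔ ∀ i, x i ≠ 0 → degree i = k := by
  rw [gradePiece_eq_span, Module.Basis.mem_span_image]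
  simp only [Set.subset_def, Finset.mem_coe, Finsupp.mem_support_iff, autBasis_repr_autOf,
    Set.mem_ofPred_eq]

/-- Every term `s p q` in coordinate `i` of `coordBracket` satisfies `degree p + degree q = degree
i`. If `degree i ≠ k + l`, all these terms vanish by the support condition on `x` and `y`. -/
theorem bracket_mem_gradePiece (k l : ℤ) {x y : autCR} (hx : x ∈ gradePiece autBasis k)
    (hy : y ∈ gradePiece autBasis l) : ⁅x, y⁆ ∈ gradePiece autBasis (k + l) := by
  obtain ⟨x, rfl⟩ := autOf_surjective x
  obtain ⟨y, rfl⟩ := autOf_surjective y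
  rw [autOf_bracket, autOf_mem_gradePiece_iff]
  rw [autOf_mem_gradePiece_iff] at hx hy
  have hp : ∀ i j, degree i + degree j ≠ k + l → x i * y j = 0 := fun i j h => by
    by_contra h0
    exact h (by rw [hx i (left_ne_zero_of_mul h0), hy j (right_ne_zero_of_mul h0)])
  have hs : ∀ i j, degree i + degree j ≠ k + l → x i * y j - x j * y i = 0 := fun i j h => by
    rw [hp i j h, hp j i (by rwa [add_comm]), sub_zero]
  intro i
  contrapose!
  intro hi
  -- In each case `hi` serves as the hypothesis of `hs`, because the sum of the two degrees computes
  -- to the degree of the coordinate.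
  fin_cases i
  · have h1 := hs 10 11 hi
    have h2 := hs 0 8 hi
    simp [coordBracket, h1, h2]
  · have h1 := hs 0 10 hi
    have h2 := hs 1 8 hi
    have h3 := hs 2 9 hi
    simp [coordBracket, h1, h2, h3]
  · have h1 := hs 0 11 hi
    have h2 := hs 2 8 hi
    have h3 := hs 1 9 hi
    simp [coordBracket, h1, h2, h3]
  · have h1 := hs 1 10 hi
    have h2 := hs 2 11 hi
    have h3 := hs 3 8 hi
    have h4 := hs 4 9 hi
    simp [coordBracket, h1, h2, h3, h4]
  · have h1 := hs 1 11 hi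
    have h2 := hs 2 10 hi
    have h3 := hs 4 8 hi
    have h4 := hs 3 9 hi
    simp [coordBracket, h1, h2, h3, h4]
  · have h1 := hs 1 10 hi
    have h2 := hs 2 11 hi
    have h3 := hs 5 8 hi
    simp [coordBracket, h1, h2, h3]
  · have h1 := hs 3 10 hi
    have h2 := hs 4 11 hi
    have h3 := hs 5 10 hi
    have h4 := hs 6 8 hi
    have h5 := hs 7 9 hi
    simp [coordBracket, h1, h2, h3, h4, h5]
  · have h1 := hs 3 11 hi
    have h2 := hs 4 10 hi
    have h3 := hs 5 11 hi
    have h4 := hs 6 9 hi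
    have h5 := hs 7 8 hi
    simp [coordBracket, h1, h2, h3, h4, h5]
  · simp [coordBracket]
  · simp [coordBracket]
  · have h1 := hs 8 10 hi
    have h2 := hs 9 11 hi
    simp [coordBracket, h1, h2]
  · have h1 := hs 8 11 hi
    have h2 := hs 9 10 hi
    simp [coordBracket, h1, h2]

/-- The entries of the table are linear in the fields, so it can be checked on coordinate vectors
and transported by `autOf`. -/
theorem map_commTable {L L' : Type*} [AddCommGroup L] [Module ℝ L] [AddCommGroup L'] [Module ℝ L']
    (f : L →ₗ[ℝ] L') (X : Fin 12 → L) (i j : Fin 12) :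
    f (commTable X i j) = commTable (fun k => f (X k)) i j := by
  fin_cases i <;> fin_cases j <;> simp [commTable]

/-- The standard basis vectors, written out. -/
noncomputable def stdVec : Fin 12 → Fin 12 → ℝ :=
  ![![1, 0, 0, 0, 0, 0, 0, 0, 0, 0, 0, 0],
    ![0, 1, 0, 0, 0, 0, 0, 0, 0, 0, 0, 0],
    ![0, 0, 1, 0, 0, 0, 0, 0, 0, 0, 0, 0],
    ![0, 0, 0, 1, 0, 0, 0, 0, 0, 0, 0, 0],
    ![0, 0, 0, 0, 1, 0, 0, 0, 0, 0, 0, 0],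
    ![0, 0, 0, 0, 0, 1, 0, 0, 0, 0, 0, 0],
    ![0, 0, 0, 0, 0, 0, 1, 0, 0, 0, 0, 0],
    ![0, 0, 0, 0, 0, 0, 0, 1, 0, 0, 0, 0],
    ![0, 0, 0, 0, 0, 0, 0, 0, 1, 0, 0, 0],
    ![0, 0, 0, 0, 0, 0, 0, 0, 0, 1, 0, 0],
    ![0, 0, 0, 0, 0, 0, 0, 0, 0, 0, 1, 0],
    ![0, 0, 0, 0, 0, 0, 0, 0, 0, 0, 0, 1]]

theorem single_eq_stdVec (k : Fin 12) : (Pi.single k 1 : Fin 12 → ℝ) = stdVec k := by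
  funext i
  fin_cases k <;> fin_cases i <;> rfl

set_option maxHeartbeats 2000000 in
theorem coordBracket_stdVec (i j : Fin 12) (hij : i ≤ j) :
    coordBracket (stdVec i) (stdVec j) = commTable stdVec i j := by
  fin_cases i <;> fin_cases j <;> first
    | exact absurd hij (by decide)
    | simp [commTable, coordBracket, stdVec]

theorem bracket_autBasis (i j : Fin 12) (hij : i ≤ j) :
    ⁅autBasis i, autBasis j⁆ = commTable autBasis i j := by
  have h : (autBasis : Fin 12 → autCR) = fun k => autOf (stdVec k) := by
    funext k
    rw [autBasis_apply, single_eq_stdVec]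
  rw [h, autOf_bracket, coordBracket_stdVec i j hij, map_commTable]

end CRModel

open CRModel
theorem theorem5p3 :
    -- the dimension
    Module.finrank ℝ autCR = 12 ∧
    -- the general coefficients
    (∀ V : Amb → Amb,
      (∃ h : (V : Germ (𝓝 (0 : Amb)) Amb) ∈ HolVF,
        (⟨(V : Germ (𝓝 (0 : Amb)) Amb), h⟩ : HolVF) ∈ autCR) ↔
      ∃ (t : Fin 8 → ℝ) (a b c d : ℝ), V =ᶠ[𝓝 0] generalField t a b c d) ∧
    -- the basis
    ∃ B : Module.Basis (Fin 12) ℝ autCR,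
      (∀ i, ((B i : HolVF) : Germ (𝓝 (0 : Amb)) Amb)
        = (basisField i : Germ (𝓝 (0 : Amb)) Amb)) ∧
      -- the grading
      DirectSum.IsInternal (gradePiece B) ∧
      (∀ k l : ℤ, ∀ x ∈ gradePiece B k, ∀ y ∈ gradePiece B l, ⁅x, y⁆ ∈ gradePiece B (k + l)) ∧
      -- the table of commutators
      (∀ i j, i ≤ j → ⁅B i, B j⁆ = commTable B i j) := by
  refine ⟨?_, mem_autCR_iff, autBasis, coe_autBasis, isInternal_gradePiece,
    fun k l x hx y hy => bracket_mem_gradePiece k l hx hy, bracket_autBasis⟩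
  rw [Module.finrank_eq_card_basis autBasis, Fintype.card_fin]
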